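/- Setting. Consider the two-stage robust optimization problem $$w^*=\min_{x\in\mathcal X}\; c_1x+\max_{u\in\mathcal U(x)}\;\min_{y\in\mathcal Y(x,u)} c_2y,$$ with $\mathcal X=\{x\in\mathbb Z_+^{m_x}\times\mathbb R_+^{n_x}: Ax\ge b\}$, $\mathcal U(x)=\{u\in\mathbb R_+^{n_u}: Fu\le h+Gx\}$ (right-hand-side dependence; $F$ has $\mu_u$ rows) and $\mathcal Y(x,u)=\{y\in\mathbb R_+^{n_y}: B_2y\ge d-B_1x-Eu\}$. Assume that $\mathcal U(x)$ is nonempty and bounded for each $x\in\mathcal X$, and that $\min\{c_1x+c_2y: x\in\mathcal X,\ u\in\mathcal U(x),\ y\in\mathcal Y(x,u)\}$ has a finite optimal value. Call $x\in\mathcal X$ feasible if $\mathcal Y(x,u)\ne\emptyset$ for all $u\in\mathcal U(x)$; the problem is infeasible if no $x\in\mathcal X$ is feasible. Let $\eta_s(x)=\max_{u\in\mathcal U(x)}\min_{y\in\mathcal Y(x,u)}c_2y\in(-\infty,+\infty]$ (a minimum over the empty set is $+\infty$), $\Pi=\{\pi\ge0: B_2^{\top}\pi\le c_2^{\top}\}$,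 and let $\mathbf{LP}(x,\beta)$ be $\max\{(-Eu)^{\top}\beta: u\in\mathcal U(x)\}$. Let $\mathcal{OU}(x,\beta)$ be the set of its KKT pairs $(u,\lambda)$: $$Fu\le h+Gx,\quad F^{\top}\lambda\ge -E^{\top}\beta,\quad \lambda\circ(h+Gx-Fu)=0,\quad u\circ(F^{\top}\lambda+E^{\top}\beta)=0,\quad u\ge0,\ \lambda\ge0 .$$ Bases. A basis is a set of $\mu_u$ columns of $[F\,|\,I]$ (variables $u$ and slacks) that are linearly independent. It is an optimal basis of $\mathbf{LP}(x,\beta)$ if its basic solution for the right-hand side $h+Gx$ is nonnegative (that is, a BFS) and all its reduced costs are nonpositive. Variant 2 (parametric C\&CG, tolerance $0$, unified cutting sets). Start with a set of cutting vectors $\Sigma=\emptyset$ and $UB=+\infty$. Each iteration $t=1,2,\dots$ performs the following steps. (a) Solve the master problem $\mathbf{MP2}$: minimize $c_1x+\eta$ subject to $x\in\mathcal X$ and, for each $\beta\in\Sigma$, $(u^\beta,\lambda^\beta)\in\mathcal{OU}(x,\beta)$, $y^\beta\in\mathcal Y(x,u^\beta)$, $\eta\ge c_2y^\beta$. If it is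 infeasible, report infeasibility and stop. Otherwise take an optimal solution with first stage part $x^t$ and let $LB$ be the optimal value. If $\Sigma=\emptyset$, then $\eta=-\infty$, $LB=-\infty$ and $x^t\in\mathcal X$ is arbitrary. The solver is assumed to return, for each $\beta\in\Sigma$, a $u^\beta$ that is a BFS of $\mathcal U(x^t)$, together with one or more optimal bases of $\mathbf{LP}(x^t,\beta)$ with that BFS. Let $\mathbb B^t$ be the set of all bases so returned. (b) Compute $\eta_f(x^t)=\max_{u\in\mathcal U(x^t)}\min\{\mathbf 1^{\top}\tilde y: B_2y+\tilde y\ge d-B_1x^t-Eu,\ y,\tilde y\ge0\}$ with a maximizer $u_f$. If $\eta_f(x^t)=0$, find a maximizer $u_s$ in $\eta_s(x^t)$ and an extreme point $\beta$ of $\Pi$ that is an optimal dual solution of the recourse problem at $(x^t,u_s)$. If $\eta_f(x^t)>0$, find an extreme ray $\beta$ of $\Pi$ with $(d-B_1x^t-Eu_f)^{\top}\beta>0$. Add $\beta$ to $\Sigma$. (c) Set $UB=\min\{UB,\,c_1x^t+\eta_s(x^t)\}$. If $UB\le LB$, stop and return the incumbent, i.e. the first iterate whose cost $c_1x+\eta_s(x)$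 equals $UB$. Otherwise go to the next iteration. Statement. For all choices made by the solvers: 1. If a basis is optimal for $\mathbf{LP}(x^0,\beta)$ and its basic solution for $\mathcal U(x^1)$ is feasible, then it is an optimal basis for $\mathbf{LP}(x^1,\beta)$ and that basic solution solves $\mathbf{LP}(x^1,\beta)$. 2. Suppose the iterations are carried on regardless of the stopping test and $\mathbb B^{t_1}=\mathbb B^{t_2}$ with $t_1<t_2$. Then the stopping test $UB\le LB$ holds in iteration $t_2$ (and already in iteration $t_1$), and $x^{t_1}$ is an optimal first stage decision. 3. Variant 2 performs at most $2^{\binom{n_u+\mu_u}{\mu_u}}$ iterations, counting an iteration in which infeasibility is reported. If it reports infeasibility, the problem is infeasible. If it stops by the stopping test, then $LB=UB=w^*$ and the returned incumbent is an optimal first stage decision. 4. Suppose the master solver always has an answer, i.e. whenever $\mathbf{MP2}$ is feasible for a finite set $\Sigma$ of extreme points and extreme rays of $\Pi$, it has an optimal solution with BFSs and optimal bases as in (a). Then every execution of Variant 2 can be continued until it stops in one of the two ways of item 3. -/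

import Mathlib

open Matrix

/-- Data of a two-stage robust optimization problem with a polyhedral uncertainty set whose
right-hand side depends on the first stage decision. The first stage decision has `mx` integer and
`nx` continuous components, the scenario `u` and the recourse decision `y` are continuous. -/
structure TwoStageRO (mx nx μx nu μu ny μy : ℕ) where
  c₁ : Fin mx ⊕ Fin nx → ℝ
  c₂ : Fin ny → ℝ
  A : Matrix (Fin μx) (Fin mx ⊕ Fin nx) ℝ
  b : Fin μx → ℝ
  F : Matrix (Fin μu) (Fin nu) ℝ
  h : Fin μu → ℝ
  G : Matrix (Fin μu) (Fin mx ⊕ Fin nx) ℝ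
  B₁ : Matrix (Fin μy) (Fin mx ⊕ Fin nx) ℝ
  B₂ : Matrix (Fin μy) (Fin ny) ℝ
  E : Matrix (Fin μy) (Fin nu) ℝ
  d : Fin μy → ℝ

namespace TwoStageRO

section Problem

variable {mx nx μx nu μu ny μy : ℕ} (I : TwoStageRO mx nx μx nu μu ny μy)

/-- First stage feasible set `𝒳 ⊆ ℤ₊^mx × ℝ₊^nx`. -/
def X : Set (Fin mx ⊕ Fin nx → ℝ) :=
  {x | 0 ≤ x ∧ (∀ i : Fin mx, ∃ z : ℤ, x (Sum.inl i) = z) ∧ I.b ≤ I.A *ᵥ x}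

/-- Right-hand side `h + G x` of the uncertainty set. -/
def rhs (x : Fin mx ⊕ Fin nx → ℝ) : Fin μu → ℝ := I.h + I.G *ᵥ x

/-- Decision-dependent uncertainty set `𝒰(x) = {u ≥ 0 : F u ≤ h + G x}`. -/
def U (x : Fin mx ⊕ Fin nx → ℝ) : Set (Fin nu → ℝ) :=
  {u | 0 ≤ u ∧ I.F *ᵥ u ≤ I.rhs x}

/-- The vector `d - B₁ x - E u`. -/
def need (x : Fin mx ⊕ Fin nx → ℝ) (u : Fin nu → ℝ) : Fin μy → ℝ :=
  I.d - I.B₁ *ᵥ x - I.E *ᵥ u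

/-- Recourse feasible set `𝒴(x, u) = {y ≥ 0 : B₂ y ≥ d - B₁ x - E u}`. -/
def Y (x : Fin mx ⊕ Fin nx → ℝ) (u : Fin nu → ℝ) : Set (Fin ny → ℝ) :=
  {y | 0 ≤ y ∧ I.need x u ≤ I.B₂ *ᵥ y}

/-- `min {c₂ y : y ∈ 𝒴(x, u)}`, equal to `+∞` when the recourse problem is infeasible. -/
noncomputable def recourseValue (x : Fin mx ⊕ Fin nx → ℝ) (u : Fin nu → ℝ) : EReal :=
  ⨅ y ∈ I.Y x u, ((I.c₂ ⬝ᵥ y : ℝ) : EReal)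

/-- Worst case recourse cost `η_s(x) = max {min {c₂ y : y ∈ 𝒴(x, u)} : u ∈ 𝒰(x)}`. -/
noncomputable def worstCase (x : Fin mx ⊕ Fin nx → ℝ) : EReal :=
  ⨆ u ∈ I.U x, I.recourseValue x u

/-- Total worst case cost `c₁ x + η_s(x)` of a first stage decision. -/
noncomputable def cost (x : Fin mx ⊕ Fin nx → ℝ) : EReal :=
  ((I.c₁ ⬝ᵥ x : ℝ) : EReal) + I.worstCase x

/-- The optimal value `w*` of the two-stage robust optimization problem. -/
noncomputable def optValue : EReal := ⨅ x ∈ I.X, I.cost x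

/-- A first stage decision is feasible if the recourse problem is feasible in every scenario. -/
def Feasible (x : Fin mx ⊕ Fin nx → ℝ) : Prop :=
  x ∈ I.X ∧ ∀ u ∈ I.U x, (I.Y x u).Nonempty

/-- The problem is infeasible if it has no feasible first stage decision. -/
def Infeasible : Prop := ∀ x, ¬ I.Feasible x

/-- `x` is an optimal first stage decision. -/
def Optimal (x : Fin mx ⊕ Fin nx → ℝ) : Prop :=
  I.Feasible x ∧ ∀ x' ∈ I.X, I.cost x ≤ I.cost x'

/-- Standing assumptions: every `𝒰(x)` is nonempty and bounded, and the mixed integer program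
`min {c₁ x + c₂ y : x ∈ 𝒳, u ∈ 𝒰(x), y ∈ 𝒴(x, u)}` has a finite optimal value. -/
structure StandingAssumptions : Prop where
  nonempty_U : ∀ x ∈ I.X, (I.U x).Nonempty
  bounded_U : ∀ x ∈ I.X, Bornology.IsBounded (I.U x)
  feasible_mip : ∃ x ∈ I.X, ∃ u ∈ I.U x, (I.Y x u).Nonempty
  bddBelow_mip :
    BddBelow {w : ℝ | ∃ x ∈ I.X, ∃ u ∈ I.U x, ∃ y ∈ I.Y x u, w = I.c₁ ⬝ᵥ x + I.c₂ ⬝ᵥ y}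

/-- The dual polyhedron `Π = {π ≥ 0 : B₂ᵀ π ≤ c₂}` of the recourse problem. -/
def dualSet : Set (Fin μy → ℝ) := {π | 0 ≤ π ∧ I.B₂ᵀ *ᵥ π ≤ I.c₂}

/-- The recession cone `{γ ≥ 0 : B₂ᵀ γ ≤ 0}` of `Π`. -/
def dualCone : Set (Fin μy → ℝ) := {γ | 0 ≤ γ ∧ I.B₂ᵀ *ᵥ γ ≤ 0}

/-- `γ` spans an extreme ray of `Π`. -/
def IsExtremeRay (γ : Fin μy → ℝ) : Prop :=
  γ ∈ I.dualCone ∧ γ ≠ 0 ∧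
    ∀ a ∈ I.dualCone, ∀ b ∈ I.dualCone, a + b = γ → ∃ s : ℝ, 0 ≤ s ∧ a = s • γ

/-! ### The linear programs `LP(x, β)` and their bases -/

/-- `u` solves `LP(x, β) : max {(-E u)ᵀ β : u ∈ 𝒰(x)}`. -/
def SolvesLP (x : Fin mx ⊕ Fin nx → ℝ) (β : Fin μy → ℝ) (u : Fin nu → ℝ) : Prop :=
  u ∈ I.U x ∧ ∀ u' ∈ I.U x, (-(I.E *ᵥ u')) ⬝ᵥ β ≤ (-(I.E *ᵥ u)) ⬝ᵥ β

/-- The optimality set `𝒪𝒰(x, β)`: the KKT pairs `(u, lam)` of `LP(x, β)`. -/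
def KKT (x : Fin mx ⊕ Fin nx → ℝ) (β : Fin μy → ℝ) : Set ((Fin nu → ℝ) × (Fin μu → ℝ)) :=
  {p | I.F *ᵥ p.1 ≤ I.rhs x ∧
    -(I.Eᵀ *ᵥ β) ≤ I.Fᵀ *ᵥ p.2 ∧
    p.2 * (I.rhs x - I.F *ᵥ p.1) = 0 ∧
    p.1 * (I.Fᵀ *ᵥ p.2 + I.Eᵀ *ᵥ β) = 0 ∧
    0 ≤ p.1 ∧ 0 ≤ p.2}

/-- Constraint matrix `[F | 1]` of the standard form of `𝒰(x)` (one slack variable per row). -/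
def stdMatrix : Matrix (Fin μu) (Fin nu ⊕ Fin μu) ℝ := Matrix.fromCols I.F 1

/-- Objective of `LP(x, β)` in standard form: `-Eᵀ β` on `u`, zero on the slacks. -/
def stdObj (β : Fin μy → ℝ) : Fin nu ⊕ Fin μu → ℝ := Sum.elim (-(I.Eᵀ *ᵥ β)) 0

/-- A basis: `μu` variables of the standard form whose columns are linearly independent. -/
def IsBasis (J : Finset (Fin nu ⊕ Fin μu)) : Prop :=
  J.card = μu ∧ LinearIndependent ℝ (fun j : J => I.stdMatrix.col j)

/-- `z` (a vector of the `u` and slack variables) is the basic solution of `J` for `𝒰(x)`. -/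
def IsBasicSolution (x : Fin mx ⊕ Fin nx → ℝ) (J : Finset (Fin nu ⊕ Fin μu))
    (z : Fin nu ⊕ Fin μu → ℝ) : Prop :=
  I.IsBasis J ∧ I.stdMatrix *ᵥ z = I.rhs x ∧ ∀ j, j ∉ J → z j = 0

/-- `z` is the basic feasible solution of `J` for `𝒰(x)`. -/
def IsBFS (x : Fin mx ⊕ Fin nx → ℝ) (J : Finset (Fin nu ⊕ Fin μu))
    (z : Fin nu ⊕ Fin μu → ℝ) : Prop :=
  I.IsBasicSolution x J z ∧ 0 ≤ z

/-- All reduced costs of `J` for the objective of `LP(·, β)` are nonpositive. The simplex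
multipliers `lam` of `J` are determined by `lam ⬝ (column j) = (objective j)`, `j ∈ J`. -/
def NonposReducedCosts (β : Fin μy → ℝ) (J : Finset (Fin nu ⊕ Fin μu)) : Prop :=
  ∃ lam : Fin μu → ℝ, (∀ j ∈ J, I.stdObj β j - (lam ᵥ* I.stdMatrix) j = 0) ∧
    ∀ j, I.stdObj β j - (lam ᵥ* I.stdMatrix) j ≤ 0

/-- `J` is an optimal basis of `LP(x, β)` with basic solution `z`: it is primal feasible and its
reduced costs are nonpositive. -/
def IsOptimalBasis (x : Fin mx ⊕ Fin nx → ℝ) (β : Fin μy → ℝ) (J : Finset (Fin nu ⊕ Fin μu))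
    (z : Fin nu ⊕ Fin μu → ℝ) : Prop :=
  I.IsBFS x J z ∧ I.NonposReducedCosts β J

/-! ### Subproblems -/

/-- Inner problem of `SP1`: `min {1ᵀ ỹ : B₂ y + ỹ ≥ d - B₁ x - E u, y ≥ 0, ỹ ≥ 0}`. -/
noncomputable def phaseOneValue (x : Fin mx ⊕ Fin nx → ℝ) (u : Fin nu → ℝ) : EReal :=
  ⨅ p ∈ {p : (Fin ny → ℝ) × (Fin μy → ℝ) |
    0 ≤ p.1 ∧ 0 ≤ p.2 ∧ I.need x u ≤ I.B₂ *ᵥ p.1 + p.2}, ((∑ i, p.2 i : ℝ) : EReal)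

/-- Optimal value `η_f(x)` of `SP1`. -/
noncomputable def etaF (x : Fin mx ⊕ Fin nx → ℝ) : EReal :=
  ⨆ u ∈ I.U x, I.phaseOneValue x u

/-- `β` is a possible outcome of the subproblems at `x`. `SP1` gives a maximizer `uf`.
If `η_f(x) = 0`, then `SP2` gives a worst case scenario `us` and an extreme point `β` of `Π` that
is an optimal dual solution for it. If `η_f(x) > 0`, then `SP3` gives an extreme ray `β` of `Π`
along which the dual of the recourse problem for `uf` is unbounded. -/
def SubproblemAnswer (x : Fin mx ⊕ Fin nx → ℝ) (β : Fin μy → ℝ) : Prop :=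
  ∃ uf ∈ I.U x, I.phaseOneValue x uf = I.etaF x ∧
    ((I.etaF x = 0 ∧ ∃ us ∈ I.U x, I.recourseValue x us = I.worstCase x ∧
        β ∈ I.dualSet.extremePoints ℝ ∧ ((I.need x us ⬝ᵥ β : ℝ) : EReal) = I.worstCase x) ∨
      (0 < I.etaF x ∧ I.IsExtremeRay β ∧ 0 < I.need x uf ⬝ᵥ β))

end Problem

/-! ### Variant 2 (parametric column-and-constraint generation) -/

/-- A candidate solution of the master problem. The families `u`, `lam`, `y` are indexed by the
vectors `β` that define the cutting sets; their values at other vectors play no role. The variable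
`η` is extended real, so that the master problem without cutting sets has optimal value `-∞`. -/
structure MasterSol (mx nx nu μu ny μy : ℕ) where
  x : Fin mx ⊕ Fin nx → ℝ
  η : EReal
  u : (Fin μy → ℝ) → Fin nu → ℝ
  lam : (Fin μy → ℝ) → Fin μu → ℝ
  y : (Fin μy → ℝ) → Fin ny → ℝ

/-- Record of one iteration: the master solution, the bases returned for each cutting set, and the
extreme point or ray of `Π` found by the subproblems. -/
structure Iter (mx nx nu μu ny μy : ℕ) extends MasterSol mx nx nu μu ny μy where
  bases : (Fin μy → ℝ) → Set (Finset (Fin nu ⊕ Fin μu))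
  cut : Fin μy → ℝ

section Algorithm

variable {mx nx μx nu μu ny μy : ℕ} (I : TwoStageRO mx nx μx nu μu ny μy)

/-- Feasibility for the master problem `MP2` with (unified) cutting sets for all `β ∈ S`. -/
def MasterFeasible (S : Set (Fin μy → ℝ)) (s : MasterSol mx nx nu μu ny μy) : Prop :=
  s.x ∈ I.X ∧ ∀ β ∈ S, (s.u β, s.lam β) ∈ I.KKT s.x β ∧ s.y β ∈ I.Y s.x (s.u β) ∧
    ((I.c₂ ⬝ᵥ s.y β : ℝ) : EReal) ≤ s.η

/-- Objective `c₁ x + η` of the master problem. -/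
noncomputable def masterObj (s : MasterSol mx nx nu μu ny μy) : EReal :=
  ((I.c₁ ⬝ᵥ s.x : ℝ) : EReal) + s.η

/-- `s` is an optimal solution of the master problem. -/
def MasterOptimal (S : Set (Fin μy → ℝ)) (s : MasterSol mx nx nu μu ny μy) : Prop :=
  I.MasterFeasible S s ∧ ∀ s', I.MasterFeasible S s' → I.masterObj s ≤ I.masterObj s'

/-- `s` with the sets of bases `bases β` is a possible answer of the master oracle: an optimal
solution in which every `u β` is a basic feasible solution of `𝒰(x)`, together with one or more
optimal bases of `LP(x, β)` whose basic solution is `u β`. -/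
def MasterAnswer (S : Set (Fin μy → ℝ)) (s : MasterSol mx nx nu μu ny μy)
    (bases : (Fin μy → ℝ) → Set (Finset (Fin nu ⊕ Fin μu))) : Prop :=
  I.MasterOptimal S s ∧ ∀ β ∈ S, (bases β).Nonempty ∧
    ∀ J ∈ bases β, ∃ z, I.IsOptimalBasis s.x β J z ∧ ∀ i, s.u β i = z (Sum.inl i)

/-- The cutting sets present in the master problem of iteration `t` (iterations are numbered from
`0`): those generated in the earlier iterations. -/
def cuts (it : ℕ → Iter mx nx nu μu ny μy) (t : ℕ) : Set (Fin μy → ℝ) :=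
  {β | ∃ s < t, β = (it s).cut}

/-- The set `𝔹^t` of all bases returned with the master solution of iteration `t`. -/
def basesAt (it : ℕ → Iter mx nx nu μu ny μy) (t : ℕ) : Set (Finset (Fin nu ⊕ Fin μu)) :=
  {J | ∃ β ∈ cuts it t, J ∈ (it t).bases β}

/-- The first `T` entries of `it` are consecutive iterations (master problem, then subproblems),
whether or not the stopping test has been met in between. -/
def IsRun (T : ℕ) (it : ℕ → Iter mx nx nu μu ny μy) : Prop :=
  ∀ t < T, I.MasterAnswer (cuts it t) (it t).toMasterSol (it t).bases ∧
    I.SubproblemAnswer (it t).x (it t).cut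

/-- Lower bound `LB` of iteration `t`. -/
noncomputable def LB (it : ℕ → Iter mx nx nu μu ny μy) (t : ℕ) : EReal :=
  I.masterObj (it t).toMasterSol

/-- Upper bound `UB` at the end of iteration `t`. -/
noncomputable def UB (it : ℕ → Iter mx nx nu μu ny μy) : ℕ → EReal
  | 0 => I.cost (it 0).x
  | t + 1 => min (UB it t) (I.cost (it (t + 1)).x)

open Classical in
/-- The incumbent at the end of iteration `t`: the first iterate whose cost is `UB`. -/
noncomputable def incumbent (it : ℕ → Iter mx nx nu μu ny μy) : ℕ → (Fin mx ⊕ Fin nx → ℝ)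
  | 0 => (it 0).x
  | t + 1 => if I.cost (it (t + 1)).x < I.UB it t then (it (t + 1)).x else incumbent it t

/-- The stopping test `UB - LB ≤ 0` of iteration `t`. -/
def StopTest (it : ℕ → Iter mx nx nu μu ny μy) (t : ℕ) : Prop := I.UB it t ≤ I.LB it t

/-- The algorithm has carried out the iterations `0, …, T - 1` completely: a new iteration is
started only if the stopping test of the previous one failed. -/
def IsExecution (T : ℕ) (it : ℕ → Iter mx nx nu μu ny μy) : Prop :=
  I.IsRun T it ∧ ∀ t, t + 1 < T → ¬ I.StopTest it t

/-- The execution stops in its last, `T`-th, iteration, because the stopping test is met. -/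
def Converges (T : ℕ) (it : ℕ → Iter mx nx nu μu ny μy) : Prop :=
  I.IsExecution T it ∧ 0 < T ∧ I.StopTest it (T - 1)

/-- After `T` complete iterations in which the stopping test failed, the master problem of the
`(T + 1)`-st iteration is infeasible; the algorithm reports infeasibility and stops. -/
def ReportsInfeasible (T : ℕ) (it : ℕ → Iter mx nx nu μu ny μy) : Prop :=
  I.IsExecution T it ∧ (∀ t < T, ¬ I.StopTest it t) ∧ ¬ ∃ s, I.MasterFeasible (cuts it T) s

/-- The oracle assumption: for every finite set of extreme points and extreme rays of `Π`, if the
master problem is feasible, then the master oracle has an answer. -/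
def MasterSolvable : Prop :=
  ∀ S : Set (Fin μy → ℝ), S.Finite → (∀ β ∈ S, β ∈ I.dualSet.extremePoints ℝ ∨ I.IsExtremeRay β) →
    (∃ s, I.MasterFeasible S s) → ∃ s bases, I.MasterAnswer S s bases

end Algorithm

end TwoStageRO

/-! The first stage decision enters `LP(x, β)` only through the right-hand side, so the reduced
costs of a basis depend on `β` but not on `x`. The heart is `IsRun.cost_le_LB`: if a basis returned
at the current iterate has nonpositive reduced costs for the newly generated cut, then its scenario,
already present in the master problem, is extremal for that cut too. If the cut is an extreme point
of `Π`, weak duality makes the master pay at least the true worst case cost, so `LB` reaches the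
cost of the iterate. If it is a ray, the recourse decision held by the master for that scenario
contradicts it. When the basis sets of iterations `t₁ < t₂` agree, any basis returned at `t₂` for
the cut of `t₁` is of this kind at `t₁`.

While the test fails, the basis sets are therefore distinct. None consists of all `μu`-subsets of
the columns, since `exists_nonposReducedCosts` finds a `μu`-subset with nonpositive reduced costs
for any cut. This leaves at most `2 ^ N - 1` failures, `N = (nu + μu).choose μu`, and room for one
final iteration.

Correctness holds because the master is a relaxation: KKT pairs always exist and their scenarios
cost no more than the worst case, so `LB ≤ w* ≤ UB`. Subproblem answers exist by compactness,
finiteness of the extreme points of `Π`, and linear programming duality, which rests on Farkas'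
lemma. -/

/-- **Farkas' lemma** for linear functionals. -/
theorem farkas_functionals {V ι : Type*} [AddCommGroup V] [Module ℝ V] (f : ι → V →ₗ[ℝ] ℝ)
    (s : Finset ι) (g : V →ₗ[ℝ] ℝ) (hg : ∀ x, (∀ i ∈ s, f i x ≤ 0) → g x ≤ 0) :
    ∃ w : ι → ℝ, 0 ≤ w ∧ ∀ x, g x = ∑ i ∈ s, w i * f i x := by
  classical
  induction s using Finset.induction_on generalizing f g with
  | empty =>
    refine ⟨0, le_rfl, fun x => ?_⟩
    have h1 := hg x (by simp)
    have h2 := hg (-x) (by simp)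
    simp only [map_neg] at h2
    simp only [Finset.sum_empty]
    linarith
  | insert a s ha ih =>
    by_cases h : ∀ x, (∀ i ∈ s, f i x ≤ 0) → g x ≤ 0
    · obtain ⟨w, hw, hgw⟩ := ih f g h
      refine ⟨Function.update w a 0, ?_, fun x => ?_⟩
      · intro i
        by_cases hi : i = a
        · subst hi; simp
        · simpa [Function.update_of_ne hi] using hw i
      · rw [Finset.sum_insert ha, hgw x]
        simp only [Function.update_self, zero_mul, zero_add]
        refine Finset.sum_congr rfl fun i hi => ?_
        rw [Function.update_of_ne (by rintro rfl; exact ha hi)]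
    · push Not at h
      obtain ⟨x₀, hx₀, hgx₀⟩ := h
      have hpos : 0 < f a x₀ := by
        by_contra hle
        push Not at hle
        exact absurd (hg x₀ (by simpa using ⟨hle, hx₀⟩)) (not_le.2 hgx₀)
      -- The constraint `a` is not redundant, and `x₀` witnesses this. Projecting along `x₀` onto
      -- the kernel of `f a` makes that constraint vacuous, so the induction hypothesis applies to
      -- the composed functionals.
      set r : V →ₗ[ℝ] V := LinearMap.id - (f a).smulRight ((f a x₀)⁻¹ • x₀) with hr
      have hrx : ∀ x, r x = x - (f a x * (f a x₀)⁻¹) • x₀ := fun x => by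
        simp [hr, mul_smul]
      obtain ⟨w, hw, hgw⟩ := ih (fun i => f i ∘ₗ r) (g ∘ₗ r) (fun x hx => hg (r x) (by
        intro i hi
        rcases Finset.mem_insert.1 hi with rfl | hi
        · rw [hrx, map_sub, map_smul, smul_eq_mul, mul_assoc, inv_mul_cancel₀ hpos.ne']
          simp
        · exact hx i hi))
      -- The weight of `a` is forced by requiring the identity at `x₀`.
      have hk : 0 ≤ (g x₀ - ∑ i ∈ s, w i * f i x₀) / f a x₀ := by
        refine div_nonneg (sub_nonneg.2 (le_trans (Finset.sum_nonpos fun i hi => ?_) hgx₀.le)) hpos.le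
        exact mul_nonpos_of_nonneg_of_nonpos (hw i) (hx₀ i hi)
      refine ⟨Function.update w a ((g x₀ - ∑ i ∈ s, w i * f i x₀) / f a x₀), ?_, fun x => ?_⟩
      · intro i
        by_cases hi : i = a
        · subst hi; simpa using hk
        · simpa [Function.update_of_ne hi] using hw i
      · have h1 := hgw x
        simp only [LinearMap.comp_apply, hrx, map_sub, map_smul, smul_eq_mul, mul_sub,
          Finset.sum_sub_distrib] at h1
        have h2 : ∑ i ∈ s, w i * (f a x * (f a x₀)⁻¹ * f i x₀) =
            f a x * (f a x₀)⁻¹ * ∑ i ∈ s, w i * f i x₀ := by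
          rw [Finset.mul_sum]
          exact Finset.sum_congr rfl fun i _ => by ring
        rw [h2] at h1
        rw [Finset.sum_insert ha, Function.update_self]
        have h3 : ∑ i ∈ s, Function.update w a ((g x₀ - ∑ i ∈ s, w i * f i x₀) / f a x₀) i * f i x =
            ∑ i ∈ s, w i * f i x := Finset.sum_congr rfl fun i hi => by
          rw [Function.update_of_ne (by rintro rfl; exact ha hi)]
        rw [h3, div_eq_mul_inv]
        linear_combination h1

/-! ### Linear programming duality and extreme points of polyhedra. -/

section LinearProgramming

variable {m n : Type*} [Fintype m] [Fintype n]

/-- **Farkas' lemma**: either `A x ≤ b`, `x ≥ 0` is solvable, or there is a certificate against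
it. -/
theorem exists_nonneg_mulVec_le (A : Matrix m n ℝ) (b : m → ℝ)
    (h : ∀ y : m → ℝ, 0 ≤ y → 0 ≤ Aᵀ *ᵥ y → 0 ≤ b ⬝ᵥ y) :
    ∃ x : n → ℝ, 0 ≤ x ∧ A *ᵥ x ≤ b := by
  classical
  obtain ⟨w, hw, hb⟩ := farkas_functionals (V := m → ℝ)
    (Sum.elim (fun i => -LinearMap.proj i)
      (fun j => -(LinearMap.proj j ∘ₗ Matrix.mulVecLin Aᵀ)) : m ⊕ n → (m → ℝ) →ₗ[ℝ] ℝ)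
    Finset.univ (-dotProductBilin ℝ ℝ b) (fun y hy => by
      simp only [Finset.mem_univ, forall_const, Sum.forall, Sum.elim_inl, Sum.elim_inr] at hy
      have := h y (fun i => by simpa using hy.1 i) (fun j => neg_nonpos.1 (hy.2 j))
      simpa using this)
  -- The multipliers of the constraints `Aᵀ y ≥ 0` form the solution; those of `y ≥ 0` are its
  -- slacks, as testing on unit vectors shows.
  refine ⟨fun j => w (Sum.inr j), fun j => hw _, fun i => ?_⟩
  have h1 := hb (Pi.single i 1)
  simp only [Fintype.sum_sum_type, Sum.elim_inl, Sum.elim_inr, LinearMap.neg_apply,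
    LinearMap.proj_apply, LinearMap.comp_apply, Matrix.mulVecLin_apply] at h1
  have h2 : ∑ a, w (Sum.inl a) * -(Pi.single i (1 : ℝ) : m → ℝ) a = -w (Sum.inl i) := by
    simp [Pi.single_apply]
  have h3 : ∑ j, w (Sum.inr j) * -(Aᵀ *ᵥ Pi.single i (1 : ℝ)) j =
      -(A *ᵥ fun j => w (Sum.inr j)) i := by
    rw [mulVec, dotProduct, ← Finset.sum_neg_distrib]
    exact Finset.sum_congr rfl fun j _ => by simp [mul_comm]
  rw [h2, h3] at h1
  have h4 : dotProductBilin ℝ ℝ b (Pi.single i 1) = b i := by simp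
  rw [h4] at h1
  have := hw (Sum.inl i)
  simp only [Pi.zero_apply] at this
  linarith

/-- Weak duality. -/
theorem dotProduct_le_of_feasible {A : Matrix m n ℝ} {b : m → ℝ} {c x : n → ℝ} {y : m → ℝ}
    (hx : 0 ≤ x) (hAx : A *ᵥ x ≤ b) (hy : 0 ≤ y) (hAy : c ≤ Aᵀ *ᵥ y) : c ⬝ᵥ x ≤ b ⬝ᵥ y :=
  calc c ⬝ᵥ x ≤ (Aᵀ *ᵥ y) ⬝ᵥ x := dotProduct_le_dotProduct_of_nonneg_right hAy hx
    _ = (A *ᵥ x) ⬝ᵥ y := by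
      rw [mulVec_transpose, ← dotProduct_mulVec, dotProduct_comm]
    _ ≤ b ⬝ᵥ y := dotProduct_le_dotProduct_of_nonneg_right hAx hy

/-- Strong duality: an upper bound of a feasible linear program is attained by a dual solution. -/
theorem exists_dual_le {A : Matrix m n ℝ} {b : m → ℝ} {c : n → ℝ} {M : ℝ}
    (hne : ∃ x : n → ℝ, 0 ≤ x ∧ A *ᵥ x ≤ b)
    (hM : ∀ x : n → ℝ, 0 ≤ x → A *ᵥ x ≤ b → c ⬝ᵥ x ≤ M) :
    ∃ y : m → ℝ, 0 ≤ y ∧ c ≤ Aᵀ *ᵥ y ∧ b ⬝ᵥ y ≤ M := by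
  obtain ⟨x₀, hx₀, hAx₀⟩ := hne
  obtain ⟨y, hy, h⟩ := exists_nonneg_mulVec_le
    (Matrix.fromRows (-Aᵀ) (Matrix.of fun _ : Unit => b)) (Sum.elim (-c) fun _ => M) (by
      intro q hq hAq
      set x : n → ℝ := fun j => q (Sum.inl j) with hx
      set t : ℝ := q (Sum.inr ()) with ht
      have hx0 : 0 ≤ x := fun j => hq _
      have ht0 : 0 ≤ t := hq _
      have hqe : q = Sum.elim x fun _ => t := by
        ext (j | j) <;> rfl
      have hAx : A *ᵥ x ≤ t • b := by
        intro i
        have := hAq i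
        rw [hqe, Matrix.transpose_fromRows, Matrix.fromCols_mulVec_sumElim] at this
        simp only [Pi.zero_apply, Pi.add_apply, transpose_neg, transpose_transpose, neg_mulVec,
          Pi.neg_apply] at this
        have h5 : ((Matrix.of fun _ : Unit => b)ᵀ *ᵥ fun _ => t) i = t * b i := by
          simp [mulVec, dotProduct, mul_comm]
        rw [h5] at this
        simp only [Pi.smul_apply, smul_eq_mul]
        linarith
      have hgoal : (Sum.elim (-c) fun _ => M : n ⊕ Unit → ℝ) ⬝ᵥ q = -(c ⬝ᵥ x) + M * t := by
        rw [hqe, sumElim_dotProduct_sumElim, neg_dotProduct]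
        simp [dotProduct]
      rw [hgoal]
      -- If `t = 0`, then `x` is a recession direction, and a positive `c ⬝ᵥ x` would push the
      -- objective beyond `M` along `x₀ + k x`. If `t > 0`, then `t⁻¹ x` is feasible.
      rcases ht0.eq_or_lt with h0 | hpos
      · by_contra hneg
        rw [← h0, mul_zero, add_zero] at hneg
        have hcx : 0 < c ⬝ᵥ x := by linarith
        obtain ⟨k, hk⟩ := exists_nat_gt ((M - c ⬝ᵥ x₀) / (c ⬝ᵥ x))
        rw [div_lt_iff₀ hcx] at hk
        have := hM (x₀ + (k : ℝ) • x) (add_nonneg hx₀ (smul_nonneg (Nat.cast_nonneg k) hx0)) (by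
          rw [mulVec_add, mulVec_smul]
          have h6 : (k : ℝ) • (A *ᵥ x) ≤ 0 := by
            rw [← h0, zero_smul] at hAx
            exact smul_nonpos_of_nonneg_of_nonpos (Nat.cast_nonneg k) hAx
          simpa using add_le_add hAx₀ h6)
        rw [dotProduct_add, dotProduct_smul, smul_eq_mul] at this
        linarith
      · have := hM (t⁻¹ • x) (smul_nonneg (inv_nonneg.2 ht0) hx0) (by
          rw [mulVec_smul]
          calc t⁻¹ • (A *ᵥ x) ≤ t⁻¹ • (t • b) := smul_le_smul_of_nonneg_left hAx (inv_nonneg.2 ht0)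
            _ = b := by rw [smul_smul, inv_mul_cancel₀ hpos.ne', one_smul])
        rw [dotProduct_smul, smul_eq_mul, inv_mul_le_iff₀ hpos] at this
        linarith)
  rw [Matrix.fromRows_mulVec] at h
  refine ⟨y, hy, fun j => ?_, ?_⟩
  · have := h (Sum.inl j)
    simp only [Sum.elim_inl, neg_mulVec, Pi.neg_apply] at this
    linarith
  · exact h (Sum.inr ())

/-- A linear functional that attains its maximum over a closed subset of the nonnegative
orthant attains it at an extreme point. -/
theorem exists_extremePoint_of_isMaxOn {P : Set (n → ℝ)} (hP : IsClosed P)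
    (hnonneg : ∀ p ∈ P, 0 ≤ p) (c : n → ℝ) {p : n → ℝ} (hp : p ∈ P)
    (hmax : ∀ q ∈ P, c ⬝ᵥ q ≤ c ⬝ᵥ p) : ∃ q ∈ P.extremePoints ℝ, c ⬝ᵥ q = c ⬝ᵥ p := by
  have hcc : Continuous fun q : n → ℝ => c ⬝ᵥ q := by fun_prop
  have hsc : Continuous fun q : n → ℝ => ∑ i, q i := by fun_prop
  -- The set `P` may be unbounded; in the nonnegative orthant a bound on the coordinate sum restores
  -- compactness.
  set K : Set (n → ℝ) := {q | q ∈ P ∧ c ⬝ᵥ q = c ⬝ᵥ p ∧ ∑ i, q i ≤ ∑ i, p i} with hK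
  have hKc : IsCompact K := by
    refine IsCompact.of_isClosed_subset (isCompact_Icc (a := (0 : n → ℝ)) (b := fun _ => ∑ i, p i))
      (hP.inter ((isClosed_eq hcc continuous_const).inter (isClosed_le hsc continuous_const)))
      (fun q hq => ⟨hnonneg q hq.1, fun i => ?_⟩)
    exact (Finset.single_le_sum (fun j _ => hnonneg q hq.1 j) (Finset.mem_univ i)).trans hq.2.2
  obtain ⟨q₀, hq₀, hmin⟩ := hKc.exists_isMinOn ⟨p, hp, rfl, le_rfl⟩ hsc.continuousOn
  -- Maximizing `c` and then minimizing the coordinate sum cuts out a compact face, so an extreme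
  -- point of `G` is extreme in `P`.
  set G : Set (n → ℝ) := {q | q ∈ P ∧ c ⬝ᵥ q = c ⬝ᵥ p ∧ ∑ i, q i = ∑ i, q₀ i} with hG
  have hlow : ∀ q ∈ P, c ⬝ᵥ q = c ⬝ᵥ p → ∑ i, q₀ i ≤ ∑ i, q i := by
    intro q hq hcq
    by_cases h : ∑ i, q i ≤ ∑ i, p i
    · exact hmin ⟨hq, hcq, h⟩
    · exact hq₀.2.2.trans (not_le.1 h).le
  have hGc : IsCompact G := by
    refine hKc.of_isClosed_subset
      (hP.inter ((isClosed_eq hcc continuous_const).inter (isClosed_eq hsc continuous_const)))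
      (fun q hq => ⟨hq.1, hq.2.1, hq.2.2.le.trans hq₀.2.2⟩)
  obtain ⟨q, hq⟩ := hGc.extremePoints_nonempty ⟨q₀, hq₀.1, hq₀.2.1, rfl⟩
  refine ⟨q, ⟨hq.1.1, fun a ha b hb hab => ?_⟩, hq.1.2.1⟩
  have hab' := hab
  obtain ⟨s, t, hs, ht, hst, hqe⟩ := hab'
  have e1 : c ⬝ᵥ p = s * (c ⬝ᵥ a) + t * (c ⬝ᵥ b) := by
    rw [← hq.1.2.1, ← hqe, dotProduct_add, dotProduct_smul, dotProduct_smul, smul_eq_mul,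
      smul_eq_mul]
  have key : ∀ {s t A B M : ℝ}, 0 < s → 0 < t → s + t = 1 → A ≤ M → B ≤ M → M = s * A + t * B →
      A = M ∧ B = M := by
    intro s t A B M hs ht hst hA hB h
    have h1 : s * (M - A) + t * (M - B) = 0 := by linear_combination M * hst + h
    have h2 := (add_eq_zero_iff_of_nonneg (mul_nonneg hs.le (sub_nonneg.2 hA))
      (mul_nonneg ht.le (sub_nonneg.2 hB))).1 h1
    exact ⟨(sub_eq_zero.1 ((mul_eq_zero.1 h2.1).resolve_left hs.ne')).symm,
      (sub_eq_zero.1 ((mul_eq_zero.1 h2.2).resolve_left ht.ne')).symm⟩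
  obtain ⟨ha1, hb1⟩ := key hs ht hst (hmax a ha) (hmax b hb) e1
  have e2 : ∑ i, q₀ i = s * ∑ i, a i + t * ∑ i, b i := by
    rw [← hq.1.2.2, ← hqe]
    simp [Finset.sum_add_distrib, Finset.mul_sum]
  obtain ⟨ha2, hb2⟩ := key hs ht hst (neg_le_neg (hlow a ha ha1)) (neg_le_neg (hlow b hb hb1))
    (by rw [e2]; ring)
  exact hq.2 ⟨ha, ha1, neg_injective ha2⟩ ⟨hb, hb1, neg_injective hb2⟩ hab

/-- A direction orthogonal to all constraints active at an extreme point of a polyhedron is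
zero. -/
theorem eq_zero_of_active_extremePoint (A : Matrix m n ℝ) (b : m → ℝ) {p v : n → ℝ}
    (hp : p ∈ {x | A *ᵥ x ≤ b}.extremePoints ℝ)
    (hv : ∀ i, (A *ᵥ p) i = b i → (A *ᵥ v) i = 0) : v = 0 := by
  -- Inactive constraints have positive slack, so `p ± ε v` stays feasible for small `ε`; as `p` is
  -- their midpoint, `v` must vanish.
  obtain ⟨ε, hε, hfeas⟩ : ∃ ε : ℝ, 0 < ε ∧ ∀ i, ε * |(A *ᵥ v) i| ≤ b i - (A *ᵥ p) i := by
    have : ∀ᶠ ε : ℝ in nhdsWithin 0 (Set.Ioi 0), ∀ i, ε * |(A *ᵥ v) i| ≤ b i - (A *ᵥ p) i := by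
      rw [Filter.eventually_all]
      intro i
      by_cases h : (A *ᵥ p) i = b i
      · simp [hv i h, h]
      · have hlt : 0 < b i - (A *ᵥ p) i := sub_pos.2 (lt_of_le_of_ne (hp.1 i) h)
        have hc : Filter.Tendsto (fun ε : ℝ => ε * |(A *ᵥ v) i|) (nhdsWithin 0 (Set.Ioi 0))
            (nhds (0 * |(A *ᵥ v) i|)) :=
          (Continuous.tendsto (by fun_prop) 0).mono_left nhdsWithin_le_nhds
        rw [zero_mul] at hc
        exact (hc.eventually_lt_const hlt).mono fun _ h => h.le
    obtain ⟨ε, h1, h2⟩ := (this.and self_mem_nhdsWithin).exists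
    exact ⟨ε, h2, h1⟩
  have hmem : ∀ s : ℝ, |s| ≤ ε → A *ᵥ (p + s • v) ≤ b := by
    intro s hs i
    rw [mulVec_add, mulVec_smul, Pi.add_apply, Pi.smul_apply, smul_eq_mul]
    have h1 : s * (A *ᵥ v) i ≤ ε * |(A *ᵥ v) i| :=
      (le_abs_self _).trans (by rw [abs_mul]; exact mul_le_mul_of_nonneg_right hs (abs_nonneg _))
    linarith [hfeas i]
  have h := hp.2 (hmem ε (by rw [abs_of_pos hε])) (hmem (-ε) (by rw [abs_neg, abs_of_pos hε]))
    ⟨1 / 2, 1 / 2, by norm_num, by norm_num, by norm_num, by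
      ext i
      simp only [Pi.add_apply, Pi.smul_apply, smul_eq_mul]
      ring⟩
  have h' : ε • v = 0 := by simpa using h
  exact (smul_eq_zero.1 h').resolve_left hε.ne'

/-- A polyhedron has finitely many extreme points. -/
theorem finite_extremePoints (A : Matrix m n ℝ) (b : m → ℝ) :
    ({x | A *ᵥ x ≤ b}.extremePoints ℝ).Finite := by
  -- An extreme point is determined by its set of active constraints.
  refine Set.Finite.of_finite_image (f := fun p => {i | (A *ᵥ p) i = b i}) (Set.toFinite _) ?_
  intro p hp q _ hpq
  refine sub_eq_zero.1 (eq_zero_of_active_extremePoint A b hp fun i hi => ?_)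
  have hq : (A *ᵥ q) i = b i := (Set.ext_iff.1 hpq i).1 hi
  rw [mulVec_sub, Pi.sub_apply, hi, hq, sub_self]

end LinearProgramming

namespace TwoStageRO

variable {mx nx μx nu μu ny μy : ℕ} {I : TwoStageRO mx nx μx nu μu ny μy}
  {x : Fin mx ⊕ Fin nx → ℝ} {u : Fin nu → ℝ} {y : Fin ny → ℝ} {β : Fin μy → ℝ}
  {J : Finset (Fin nu ⊕ Fin μu)} {z : Fin nu ⊕ Fin μu → ℝ}

/-! ### The scenario problems `LP(x, β)` -/

theorem neg_mulVec_dotProduct (u : Fin nu → ℝ) (β : Fin μy → ℝ) :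
    (-(I.E *ᵥ u)) ⬝ᵥ β = (-(I.Eᵀ *ᵥ β)) ⬝ᵥ u := by
  rw [neg_dotProduct, neg_dotProduct, mulVec_transpose, ← dotProduct_mulVec, dotProduct_comm]

theorem need_dotProduct (x : Fin mx ⊕ Fin nx → ℝ) (u : Fin nu → ℝ) (β : Fin μy → ℝ) :
    I.need x u ⬝ᵥ β = (I.d - I.B₁ *ᵥ x) ⬝ᵥ β + (-(I.E *ᵥ u)) ⬝ᵥ β := by
  rw [need, sub_dotProduct _ (I.E *ᵥ u), neg_dotProduct, sub_eq_add_neg]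

theorem stdObj_dotProduct (β : Fin μy → ℝ) (z : Fin nu ⊕ Fin μu → ℝ) :
    I.stdObj β ⬝ᵥ z = (-(I.E *ᵥ fun i => z (Sum.inl i))) ⬝ᵥ β := by
  rw [neg_mulVec_dotProduct, stdObj]
  simp [dotProduct]

theorem stdMatrix_mulVec (z : Fin nu ⊕ Fin μu → ℝ) :
    I.stdMatrix *ᵥ z = I.F *ᵥ (fun i => z (Sum.inl i)) + fun i => z (Sum.inr i) := by
  rw [stdMatrix, fromCols_mulVec, one_mulVec]
  rfl

theorem vecMul_stdMatrix (lam : Fin μu → ℝ) :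
    lam ᵥ* I.stdMatrix = Sum.elim (I.Fᵀ *ᵥ lam) lam := by
  rw [stdMatrix, vecMul_fromCols, vecMul_one, mulVec_transpose]

theorem IsBFS.mem_U (hz : I.IsBFS x J z) : (fun i => z (Sum.inl i)) ∈ I.U x := by
  refine ⟨fun i => hz.2 _, ?_⟩
  rw [← hz.1.2.1, stdMatrix_mulVec]
  exact le_add_of_nonneg_right fun i => hz.2 _

/-- A feasible basic solution with nonpositive reduced costs solves the linear program. -/
theorem IsOptimalBasis.solvesLP (hz : I.IsOptimalBasis x β J z) :
    I.SolvesLP x β (fun i => z (Sum.inl i)) := by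
  refine ⟨hz.1.mem_U, fun u hu => ?_⟩
  obtain ⟨lam, hJ, hle⟩ := hz.2
  set z' : Fin nu ⊕ Fin μu → ℝ := Sum.elim u (I.rhs x - I.F *ᵥ u) with hz'
  have hz'0 : 0 ≤ z' := by
    rintro (i | i)
    · exact hu.1 i
    · exact sub_nonneg.2 (hu.2 i)
  have hMz' : I.stdMatrix *ᵥ z' = I.rhs x := by
    rw [stdMatrix_mulVec]
    exact add_sub_cancel _ _
  have h1 : I.stdObj β ⬝ᵥ z' ≤ (lam ᵥ* I.stdMatrix) ⬝ᵥ z' :=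
    dotProduct_le_dotProduct_of_nonneg_right (fun j => sub_nonpos.1 (hle j)) hz'0
  have h2 : (lam ᵥ* I.stdMatrix) ⬝ᵥ z = I.stdObj β ⬝ᵥ z := by
    refine Finset.sum_congr rfl fun j _ => ?_
    by_cases hj : j ∈ J
    · rw [sub_eq_zero.1 (hJ j hj)]
    · rw [hz.1.1.2.2 j hj, mul_zero, mul_zero]
  rw [← dotProduct_mulVec, hMz', ← hz.1.1.2.1, dotProduct_mulVec, h2] at h1
  rw [stdObj_dotProduct, stdObj_dotProduct] at h1
  exact h1

theorem isCompact_U (hI : I.StandingAssumptions) (hx : x ∈ I.X) : IsCompact (I.U x) := by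
  refine Metric.isCompact_of_isClosed_isBounded ?_ (hI.bounded_U x hx)
  exact isClosed_Ici.inter (isClosed_le (Continuous.matrix_mulVec continuous_const continuous_id)
    continuous_const)

/-- The lower level problem has a KKT pair. -/
theorem exists_mem_KKT (hI : I.StandingAssumptions) (hx : x ∈ I.X) (β : Fin μy → ℝ) :
    ∃ p, p ∈ I.KKT x β := by
  obtain ⟨u, hu, hmax⟩ := (isCompact_U hI hx).exists_isMaxOn (hI.nonempty_U x hx)
    (f := fun u => (-(I.Eᵀ *ᵥ β)) ⬝ᵥ u) (by fun_prop)
  obtain ⟨lam, hlam, hdual, hle⟩ := exists_dual_le (A := I.F) (b := I.rhs x)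
    (c := -(I.Eᵀ *ᵥ β)) (M := (-(I.Eᵀ *ᵥ β)) ⬝ᵥ u) ⟨u, hu⟩ (fun u' h h' => hmax ⟨h, h'⟩)
  have hs : 0 ≤ I.rhs x - I.F *ᵥ u := sub_nonneg.2 hu.2
  have hr : 0 ≤ I.Fᵀ *ᵥ lam + I.Eᵀ *ᵥ β := by
    simpa using sub_nonneg.2 hdual
  -- The left side is the duality gap. Both products are sums of nonnegative terms, so
  -- complementarity holds coordinatewise.
  have hsum : lam ⬝ᵥ (I.rhs x - I.F *ᵥ u) + u ⬝ᵥ (I.Fᵀ *ᵥ lam + I.Eᵀ *ᵥ β) ≤ 0 := by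
    have e1 : lam ⬝ᵥ (I.F *ᵥ u) = u ⬝ᵥ (I.Fᵀ *ᵥ lam) := by
      rw [dotProduct_mulVec, mulVec_transpose, dotProduct_comm]
    rw [neg_dotProduct, dotProduct_comm _ u, dotProduct_comm _ lam] at hle
    rw [dotProduct_sub, dotProduct_add, e1]
    linarith
  have h1 : 0 ≤ lam ⬝ᵥ (I.rhs x - I.F *ᵥ u) := dotProduct_nonneg_of_nonneg hlam hs
  have h2 : 0 ≤ u ⬝ᵥ (I.Fᵀ *ᵥ lam + I.Eᵀ *ᵥ β) := dotProduct_nonneg_of_nonneg hu.1 hr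
  refine ⟨(u, lam), hu.2, hdual, ?_, ?_, hu.1, hlam⟩
  · have h0 : lam ⬝ᵥ (I.rhs x - I.F *ᵥ u) = 0 := by linarith
    ext i
    exact (Finset.sum_eq_zero_iff_of_nonneg fun i _ => mul_nonneg (hlam i) (hs i)).1 h0 i
      (Finset.mem_univ i)
  · have h0 : u ⬝ᵥ (I.Fᵀ *ᵥ lam + I.Eᵀ *ᵥ β) = 0 := by linarith
    ext i
    exact (Finset.sum_eq_zero_iff_of_nonneg fun i _ => mul_nonneg (hu.1 i) (hr i)).1 h0 i
      (Finset.mem_univ i)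

/-- A vertex of the dual polyhedron gives `μu` variables with vanishing reduced cost. -/
theorem exists_nonposReducedCosts (hI : I.StandingAssumptions) (hx : x ∈ I.X)
    (β : Fin μy → ℝ) :
    ∃ J : Finset (Fin nu ⊕ Fin μu), J.card = μu ∧ I.NonposReducedCosts β J := by
  classical
  obtain ⟨⟨u, lam₀⟩, h⟩ := exists_mem_KKT hI hx β
  set P : Set (Fin μu → ℝ) := {lam | (-I.stdMatrixᵀ) *ᵥ lam ≤ -I.stdObj β} with hP
  have hmem : ∀ lam, lam ∈ P ↔ I.stdObj β ≤ lam ᵥ* I.stdMatrix := by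
    intro lam
    rw [hP, Set.mem_ofPred_eq, neg_mulVec, mulVec_transpose, neg_le_neg_iff]
  have hmem₀ : lam₀ ∈ P := by
    rw [hmem, vecMul_stdMatrix]
    rintro (i | i)
    · exact h.2.1 i
    · exact h.2.2.2.2.2 i
  have hnonneg : ∀ lam ∈ P, 0 ≤ lam := by
    intro lam hlam i
    have := (hmem lam).1 hlam (Sum.inr i)
    rwa [vecMul_stdMatrix] at this
  obtain ⟨lam, hlam, -⟩ := exists_extremePoint_of_isMaxOn
    (isClosed_le (by fun_prop) continuous_const : IsClosed P) hnonneg 0 hmem₀ (by simp)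
  set K : Finset (Fin nu ⊕ Fin μu) :=
    Finset.univ.filter fun j => (lam ᵥ* I.stdMatrix) j = I.stdObj β j with hK
  -- With fewer than `μu` tight columns, some nonzero direction would be orthogonal to all of them,
  -- contradicting extremality of `lam`.
  have hcard : μu ≤ K.card := by
    by_contra hlt
    push Not at hlt
    have hrank : Module.finrank ℝ (K → ℝ) < Module.finrank ℝ (Fin μu → ℝ) := by simpa using hlt
    have hker := LinearMap.ker_ne_bot_of_finrank_lt
      (f := (LinearMap.funLeft ℝ ℝ (fun j : K => (j : Fin nu ⊕ Fin μu))) ∘ₗ I.stdMatrix.vecMulLinear)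
      hrank
    obtain ⟨v, hv, hv0⟩ := (Submodule.ne_bot_iff _).1 hker
    refine hv0 (eq_zero_of_active_extremePoint _ _ hlam fun j hj => ?_)
    rw [neg_mulVec, mulVec_transpose, Pi.neg_apply, Pi.neg_apply, neg_inj] at hj
    rw [neg_mulVec, mulVec_transpose, Pi.neg_apply, neg_eq_zero]
    exact congrFun (LinearMap.mem_ker.1 hv) ⟨j, by simpa [hK] using hj⟩
  -- Linear independence of the chosen columns is not claimed: the count of iterations uses only the
  -- cardinality.
  obtain ⟨J, hJK, hJ⟩ := Finset.exists_subset_card_eq hcard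
  refine ⟨J, hJ, lam, fun j hj => ?_, fun j => sub_nonpos.2 ((hmem lam).1 hlam.1 j)⟩
  rw [sub_eq_zero]
  exact (Finset.mem_filter.1 (hJK hj)).2.symm

/-! ### The recourse problem and its dual -/

theorem isClosed_dualSet : IsClosed I.dualSet :=
  isClosed_Ici.inter (isClosed_le (Continuous.matrix_mulVec continuous_const continuous_id)
    continuous_const)

theorem isClosed_dualCone : IsClosed I.dualCone :=
  isClosed_Ici.inter (isClosed_le (Continuous.matrix_mulVec continuous_const continuous_id)
    continuous_const)

theorem need_dotProduct_le_of_mem_dualSet (hβ : β ∈ I.dualSet) (hy : y ∈ I.Y x u) :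
    I.need x u ⬝ᵥ β ≤ I.c₂ ⬝ᵥ y :=
  dotProduct_le_of_feasible (A := I.B₂ᵀ) hβ.1 hβ.2 hy.1 hy.2

theorem need_dotProduct_nonpos_of_mem_dualCone (hβ : β ∈ I.dualCone) (hy : y ∈ I.Y x u) :
    I.need x u ⬝ᵥ β ≤ 0 := by
  simpa using dotProduct_le_of_feasible (A := I.B₂ᵀ) hβ.1 hβ.2 hy.1 hy.2

theorem mem_Y_iff : y ∈ I.Y x u ↔ 0 ≤ y ∧ (-I.B₂) *ᵥ y ≤ -I.need x u := by
  rw [neg_mulVec, neg_le_neg_iff]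
  rfl

/-- An infeasible recourse problem has an unbounded dual ray. -/
theorem exists_mem_dualCone (h : ¬ (I.Y x u).Nonempty) :
    ∃ γ ∈ I.dualCone, 0 < I.need x u ⬝ᵥ γ := by
  by_contra! hno
  refine h ?_
  obtain ⟨y, hy⟩ := exists_nonneg_mulVec_le (-I.B₂) (-I.need x u) (fun γ hγ hB => by
    rw [neg_dotProduct, neg_nonneg]
    rw [transpose_neg, neg_mulVec, le_neg, neg_zero] at hB
    exact hno γ ⟨hγ, hB⟩)
  exact ⟨y, mem_Y_iff.2 hy⟩

theorem exists_mem_dualSet_of_le {M : ℝ} (hY : (I.Y x u).Nonempty)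
    (hM : ∀ y ∈ I.Y x u, M ≤ I.c₂ ⬝ᵥ y) : ∃ π ∈ I.dualSet, M ≤ I.need x u ⬝ᵥ π := by
  obtain ⟨y, hy⟩ := hY
  obtain ⟨π, hπ, hB, hle⟩ := exists_dual_le (A := -I.B₂) (b := -I.need x u) (c := -I.c₂) (M := -M)
    ⟨y, mem_Y_iff.1 hy⟩ (fun y h h' => by
      rw [neg_dotProduct]
      exact neg_le_neg (hM y (mem_Y_iff.2 ⟨h, h'⟩)))
  rw [transpose_neg, neg_mulVec, neg_le_neg_iff] at hB
  rw [neg_dotProduct] at hle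
  exact ⟨π, ⟨hπ, hB⟩, neg_le_neg_iff.1 hle⟩

/-- Fixing a feasible pair `(x, u)`, the lower bound on the mixed integer program bounds the
recourse problem from below, and strong duality yields a dual point. -/
theorem dualSet_nonempty (hI : I.StandingAssumptions) : I.dualSet.Nonempty := by
  obtain ⟨x, hx, u, hu, hY⟩ := hI.feasible_mip
  obtain ⟨w, hw⟩ := hI.bddBelow_mip
  obtain ⟨π, hπ, -⟩ := exists_mem_dualSet_of_le (M := w - I.c₁ ⬝ᵥ x) hY
    (fun y hy => sub_le_iff_le_add'.2 (hw ⟨x, hx, u, hu, y, hy, rfl⟩))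
  exact ⟨π, hπ⟩

theorem exists_mem_Y_le {M : ℝ} (hne : I.dualSet.Nonempty)
    (hM : ∀ π ∈ I.dualSet, I.need x u ⬝ᵥ π ≤ M) : ∃ y ∈ I.Y x u, I.c₂ ⬝ᵥ y ≤ M := by
  obtain ⟨y, hy, hB, hle⟩ := exists_dual_le (A := I.B₂ᵀ) (b := I.c₂) (c := I.need x u) (M := M)
    hne (fun π h h' => hM π ⟨h, h'⟩)
  exact ⟨y, ⟨hy, hB⟩, hle⟩

/-- The dual of a feasible recourse problem attains its maximum at an extreme point. -/
theorem exists_extremePoint_dual (hne : I.dualSet.Nonempty) (hY : (I.Y x u).Nonempty) :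
    ∃ β ∈ I.dualSet.extremePoints ℝ, ∀ π ∈ I.dualSet, I.need x u ⬝ᵥ π ≤ I.need x u ⬝ᵥ β := by
  have hbdd : ∀ y ∈ I.Y x u, I.c₂ ⬝ᵥ y ∈ upperBounds ((fun π => I.need x u ⬝ᵥ π) '' I.dualSet) := by
    rintro y hy _ ⟨π, hπ, rfl⟩
    exact need_dotProduct_le_of_mem_dualSet hπ hy
  -- The bound supplied to strong duality is the supremum of the dual values, so `π` attains it.
  obtain ⟨π, hπ, hle⟩ := exists_mem_dualSet_of_le hY fun y hy =>
    csSup_le (hne.image _) (hbdd y hy)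
  have hmax : ∀ q ∈ I.dualSet, I.need x u ⬝ᵥ q ≤ I.need x u ⬝ᵥ π := fun q hq =>
    (le_csSup (hY.elim fun y hy => ⟨_, hbdd y hy⟩) ⟨q, hq, rfl⟩).trans hle
  obtain ⟨β, hβ, he⟩ := exists_extremePoint_of_isMaxOn isClosed_dualSet (fun p hp => hp.1)
    (I.need x u) hπ hmax
  exact ⟨β, hβ, fun q hq => he ▸ hmax q hq⟩

theorem finite_extremePoints_dualSet : (I.dualSet.extremePoints ℝ).Finite := by
  have h := finite_extremePoints (Matrix.fromRows (-1 : Matrix (Fin μy) (Fin μy) ℝ) I.B₂ᵀ) (Sum.elim 0 I.c₂)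
  convert h using 2
  ext π
  simp [dualSet, fromRows_mulVec, neg_mulVec, Pi.le_def, Sum.forall]

theorem continuous_need_dotProduct :
    Continuous fun p : (Fin nu → ℝ) × (Fin μy → ℝ) => I.need x p.1 ⬝ᵥ p.2 := by
  unfold need
  fun_prop

/-- If the recourse problem is feasible in every scenario, then the worst case is attained, with an
extreme point of the dual polyhedron as a dual solution. -/
theorem exists_worstCase (hI : I.StandingAssumptions) (hx : I.Feasible x) :
    ∃ us ∈ I.U x, I.recourseValue x us = I.worstCase x ∧
      ∃ β ∈ I.dualSet.extremePoints ℝ, ((I.need x us ⬝ᵥ β : ℝ) : EReal) = I.worstCase x := by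
  have hne := dualSet_nonempty hI
  obtain ⟨u₀, hu₀⟩ := hI.nonempty_U x hx.1
  obtain ⟨β₀, hβ₀, -⟩ := exists_extremePoint_dual hne (hx.2 u₀ hu₀)
  -- Only finitely many extreme points matter, so scenario and dual vector can be maximized jointly
  -- over a compact set although `Π` may be unbounded.
  obtain ⟨⟨us, β⟩, ⟨hus, hβ⟩, hmax⟩ :=
    ((isCompact_U hI hx.1).prod finite_extremePoints_dualSet.isCompact).exists_isMaxOn
      ⟨(u₀, β₀), hu₀, hβ₀⟩ (continuous_need_dotProduct (I := I) (x := x)).continuousOn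
  have hup : ∀ u ∈ I.U x, I.recourseValue x u ≤ ((I.need x us ⬝ᵥ β : ℝ) : EReal) := by
    intro u hu
    obtain ⟨β', hβ', hβ'max⟩ := exists_extremePoint_dual hne (hx.2 u hu)
    obtain ⟨y, hy, hle⟩ := exists_mem_Y_le hne
      (fun π hπ => (hβ'max π hπ).trans (hmax (show (u, β') ∈ _ from ⟨hu, hβ'⟩)))
    exact (iInf₂_le y hy).trans (EReal.coe_le_coe_iff.2 hle)
  have hlow : ((I.need x us ⬝ᵥ β : ℝ) : EReal) ≤ I.recourseValue x us :=
    le_iInf₂ fun y hy => EReal.coe_le_coe_iff.2 (need_dotProduct_le_of_mem_dualSet hβ.1 hy)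
  have hsup : I.worstCase x = ((I.need x us ⬝ᵥ β : ℝ) : EReal) :=
    le_antisymm (iSup₂_le hup) (hlow.trans (le_iSup₂ (f := fun u _ => I.recourseValue x u) us hus))
  exact ⟨us, hus, by rw [hsup]; exact le_antisymm (hup us hus) hlow, β, hβ, hsup.symm⟩

theorem feasible_of_worstCase_lt_top (hx : x ∈ I.X) (h : I.worstCase x < ⊤) : I.Feasible x := by
  refine ⟨hx, fun u hu => ?_⟩
  by_contra hY
  rw [Set.not_nonempty_iff_eq_empty] at hY
  have h1 : I.recourseValue x u = ⊤ := by simp [recourseValue, hY]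
  exact (h1 ▸ (le_iSup₂ (f := fun u _ => I.recourseValue x u) u hu).trans_lt h).ne rfl

/-! ### The feasibility problem -/

/-- Weak duality: the artificial variables add the bound `π ≤ 1` to the recession cone. -/
theorem le_phaseOneValue {π : Fin μy → ℝ} (hπ : π ∈ I.dualCone) (hπ1 : π ≤ 1) :
    ((I.need x u ⬝ᵥ π : ℝ) : EReal) ≤ I.phaseOneValue x u := by
  refine le_iInf₂ fun p hp => EReal.coe_le_coe_iff.2 ?_
  obtain ⟨h1, h2, h3⟩ := hp
  calc I.need x u ⬝ᵥ π ≤ (I.B₂ *ᵥ p.1 + p.2) ⬝ᵥ π :=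
        dotProduct_le_dotProduct_of_nonneg_right h3 hπ.1
    _ = (I.B₂ᵀ *ᵥ π) ⬝ᵥ p.1 + π ⬝ᵥ p.2 := by
      rw [add_dotProduct, mulVec_transpose, ← dotProduct_mulVec, dotProduct_comm p.2,
        dotProduct_comm π (I.B₂ *ᵥ p.1)]
    _ ≤ 0 ⬝ᵥ p.1 + 1 ⬝ᵥ p.2 := add_le_add (dotProduct_le_dotProduct_of_nonneg_right hπ.2 h1)
        (dotProduct_le_dotProduct_of_nonneg_right hπ1 h2)
    _ = ∑ i, p.2 i := by rw [zero_dotProduct, one_dotProduct, zero_add]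

/-- The strong duality counterpart; the multipliers of `π ≤ 1` serve as the artificial variables. -/
theorem phaseOneValue_le {M : ℝ} (hM : ∀ π ∈ I.dualCone, π ≤ 1 → I.need x u ⬝ᵥ π ≤ M) :
    I.phaseOneValue x u ≤ (M : EReal) := by
  obtain ⟨q, hq, hA, hle⟩ := exists_dual_le (A := Matrix.fromRows I.B₂ᵀ 1)
    (b := Sum.elim 0 1) (c := I.need x u) (M := M)
    ⟨0, le_rfl, by
      rw [mulVec_zero]
      rintro (i | i) <;> simp⟩
    (fun π hπ hA => by
      rw [fromRows_mulVec, one_mulVec] at hA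
      exact hM π ⟨hπ, fun i => hA (Sum.inl i)⟩ fun i => hA (Sum.inr i))
  refine (iInf₂_le (fun j => q (Sum.inl j), fun i => q (Sum.inr i)) ⟨fun j => hq _, fun i => hq _,
    ?_⟩).trans (EReal.coe_le_coe_iff.2 (le_trans (le_of_eq ?_) hle))
  · simp [dotProduct]
  · rw [transpose_fromRows, transpose_transpose, transpose_one, fromCols_mulVec, one_mulVec] at hA
    exact hA

theorem phaseOneValue_nonneg : 0 ≤ I.phaseOneValue x u := by
  have h := le_phaseOneValue (I := I) (x := x) (u := u) (π := 0) ⟨le_rfl, by simp⟩ (fun _ => zero_le_one)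
  simpa using h

theorem phaseOneValue_pos_of_mem_dualCone {γ : Fin μy → ℝ} (hγ : γ ∈ I.dualCone)
    (hpos : 0 < I.need x u ⬝ᵥ γ) : 0 < I.phaseOneValue x u := by
  have hs : 0 ≤ ∑ i, γ i := Finset.sum_nonneg fun i _ => hγ.1 i
  -- This scaling brings the ray into the box `π ≤ 1`; the added `1` avoids division by zero.
  set s : ℝ := (1 + ∑ i, γ i)⁻¹ with hsdef
  have hs0 : 0 < s := inv_pos.2 (by linarith)
  have hle := le_phaseOneValue (I := I) (x := x) (u := u) (π := s • γ)
    ⟨smul_nonneg hs0.le hγ.1, by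
      rw [mulVec_smul]
      exact smul_nonpos_of_nonneg_of_nonpos hs0.le hγ.2⟩
    (fun i => by
      rw [Pi.smul_apply, smul_eq_mul, Pi.one_apply, hsdef, inv_mul_le_iff₀ (by linarith), mul_one]
      have := Finset.single_le_sum (fun j _ => hγ.1 j) (Finset.mem_univ i)
      linarith)
  refine lt_of_lt_of_le ?_ hle
  rw [dotProduct_smul, smul_eq_mul]
  exact_mod_cast mul_pos hs0 hpos

theorem etaF_nonneg (hI : I.StandingAssumptions) (hx : x ∈ I.X) : 0 ≤ I.etaF x := by
  obtain ⟨u, hu⟩ := hI.nonempty_U x hx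
  exact phaseOneValue_nonneg.trans (le_iSup₂ (f := fun u _ => I.phaseOneValue x u) u hu)

theorem feasible_of_etaF_eq_zero (hx : x ∈ I.X) (h : I.etaF x = 0) : I.Feasible x := by
  refine ⟨hx, fun u hu => ?_⟩
  by_contra hY
  obtain ⟨γ, hγ, hpos⟩ := exists_mem_dualCone hY
  exact ((phaseOneValue_pos_of_mem_dualCone hγ hpos).trans_le
    (le_iSup₂ (f := fun u _ => I.phaseOneValue x u) u hu)).ne h.symm

theorem exists_etaF (hI : I.StandingAssumptions) (hx : x ∈ I.X) :
    ∃ uf ∈ I.U x, I.phaseOneValue x uf = I.etaF x ∧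
      ∃ π ∈ I.dualCone, ((I.need x uf ⬝ᵥ π : ℝ) : EReal) = I.etaF x := by
  set P : Set (Fin μy → ℝ) := {π | π ∈ I.dualCone ∧ π ≤ 1} with hP
  have hPc : IsCompact P := by
    refine (isCompact_Icc (a := (0 : Fin μy → ℝ)) (b := 1)).of_isClosed_subset ?_
      (fun π hπ => ⟨hπ.1.1, hπ.2⟩)
    exact isClosed_dualCone.inter isClosed_Iic
  obtain ⟨u₀, hu₀⟩ := hI.nonempty_U x hx
  obtain ⟨⟨uf, π⟩, ⟨huf, hπ⟩, hmax⟩ := ((isCompact_U hI hx).prod hPc).exists_isMaxOn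
    ⟨(u₀, 0), hu₀, ⟨le_rfl, by simp⟩, fun _ => zero_le_one⟩
    (continuous_need_dotProduct (I := I) (x := x)).continuousOn
  have hup : ∀ u ∈ I.U x, I.phaseOneValue x u ≤ ((I.need x uf ⬝ᵥ π : ℝ) : EReal) := fun u hu =>
    phaseOneValue_le fun π' h h' => hmax (show (u, π') ∈ _ from ⟨hu, h, h'⟩)
  have hlow := le_phaseOneValue (I := I) (x := x) (u := uf) hπ.1 hπ.2
  have hsup : I.etaF x = ((I.need x uf ⬝ᵥ π : ℝ) : EReal) :=
    le_antisymm (iSup₂_le hup) (hlow.trans (le_iSup₂ (f := fun u _ => I.phaseOneValue x u) uf huf))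
  exact ⟨uf, huf, by rw [hsup]; exact le_antisymm (hup uf huf) hlow, π, hπ.1, hsup.symm⟩

/-- A functional positive somewhere on the recession cone is positive on an extreme ray. -/
theorem exists_isExtremeRay (c : Fin μy → ℝ) {γ : Fin μy → ℝ} (hγ : γ ∈ I.dualCone)
    (hpos : 0 < c ⬝ᵥ γ) : ∃ β, I.IsExtremeRay β ∧ 0 < c ⬝ᵥ β := by
  have hsmul : ∀ {a : Fin μy → ℝ} {s : ℝ}, 0 ≤ s → a ∈ I.dualCone → s • a ∈ I.dualCone := by
    intro a s hs ha
    refine ⟨smul_nonneg hs ha.1, ?_⟩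
    rw [mulVec_smul]
    exact smul_nonpos_of_nonneg_of_nonpos hs ha.2
  have hzero : ∀ {a : Fin μy → ℝ}, a ∈ I.dualCone → ∑ i, a i = 0 → a = 0 := by
    intro a ha h0
    ext i
    exact (Finset.sum_eq_zero_iff_of_nonneg fun i _ => ha.1 i).1 h0 i (Finset.mem_univ i)
  -- A compact base of the cone, whose extreme points span extreme rays.
  set Q : Set (Fin μy → ℝ) := {q | q ∈ I.dualCone ∧ ∑ i, q i = 1} with hQ
  have hQclosed : IsClosed Q :=
    isClosed_dualCone.inter (isClosed_eq (f := fun q : Fin μy → ℝ => ∑ i, q i) (by fun_prop)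
      continuous_const)
  have hQc : IsCompact Q := by
    refine (isCompact_Icc (a := (0 : Fin μy → ℝ)) (b := 1)).of_isClosed_subset hQclosed
      (fun q hq => ⟨hq.1.1, fun i => ?_⟩)
    have := Finset.single_le_sum (fun j _ => hq.1.1 j) (Finset.mem_univ i)
    rwa [hq.2] at this
  have hnorm : ∀ {a : Fin μy → ℝ}, a ∈ I.dualCone → 0 < ∑ i, a i → (∑ i, a i)⁻¹ • a ∈ Q := by
    intro a ha h
    refine ⟨hsmul (inv_nonneg.2 h.le) ha, ?_⟩
    simp only [Pi.smul_apply, smul_eq_mul]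
    rw [← Finset.mul_sum, inv_mul_cancel₀ h.ne']
  have hsum0 : ∀ {a : Fin μy → ℝ}, a ∈ I.dualCone → 0 ≤ ∑ i, a i := fun ha =>
    Finset.sum_nonneg fun i _ => ha.1 i
  have hγ0 : 0 < ∑ i, γ i := by
    refine lt_of_le_of_ne (hsum0 hγ) fun h => ?_
    rw [hzero hγ h.symm, dotProduct_zero] at hpos
    exact lt_irrefl _ hpos
  obtain ⟨p, hp, hmax⟩ := hQc.exists_isMaxOn ⟨_, hnorm hγ hγ0⟩ (f := fun q => c ⬝ᵥ q) (by fun_prop)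
  obtain ⟨β, hβ, he⟩ := exists_extremePoint_of_isMaxOn hQclosed (fun q hq => hq.1.1) c hp
    (fun q hq => hmax hq)
  refine ⟨β, ⟨hβ.1.1, ?_, fun a ha b hb hab => ?_⟩, ?_⟩
  · rintro rfl
    simpa using hβ.1.2
  · have hab1 : ∑ i, a i + ∑ i, b i = 1 := by
      rw [← Finset.sum_add_distrib, ← hβ.1.2, ← hab]
      rfl
    rcases (hsum0 ha).eq_or_lt with h | hapos
    · exact ⟨0, le_rfl, by rw [hzero ha h.symm, zero_smul]⟩
    rcases (hsum0 hb).eq_or_lt with h | hbpos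
    · refine ⟨1, zero_le_one, ?_⟩
      rw [hzero hb h.symm, add_zero] at hab
      rw [hab, one_smul]
    -- The point `β` is a convex combination of the normalized `a` and `b`, the weights being their
    -- coordinate sums.
    · have := hβ.2 (hnorm ha hapos) (hnorm hb hbpos)
        ⟨∑ i, a i, ∑ i, b i, hapos, hbpos, hab1, by
          rw [smul_smul, smul_smul, mul_inv_cancel₀ hapos.ne', mul_inv_cancel₀ hbpos.ne', one_smul,
            one_smul, hab]⟩
      refine ⟨∑ i, a i, hapos.le, ?_⟩
      rw [← this, smul_smul, mul_inv_cancel₀ hapos.ne', one_smul]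
  · rw [he]
    refine lt_of_lt_of_le ?_ (hmax (hnorm hγ hγ0))
    simp only [dotProduct_smul, smul_eq_mul]
    exact mul_pos (inv_pos.2 hγ0) hpos

theorem exists_subproblemAnswer (hI : I.StandingAssumptions) (hx : x ∈ I.X) :
    ∃ β, I.SubproblemAnswer x β := by
  obtain ⟨uf, huf, he, π, hπ, hπe⟩ := exists_etaF hI hx
  rcases (etaF_nonneg hI hx).eq_or_lt with h0 | hpos
  · obtain ⟨us, hus, hval, β, hβ, hβe⟩ := exists_worstCase hI (feasible_of_etaF_eq_zero hx h0.symm)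
    exact ⟨β, uf, huf, he, Or.inl ⟨h0.symm, us, hus, hval, hβ, hβe⟩⟩
  · obtain ⟨β, hβ, hβpos⟩ := exists_isExtremeRay (I.need x uf) hπ (by
      rw [← hπe] at hpos
      exact_mod_cast hpos)
    exact ⟨β, uf, huf, he, Or.inr ⟨hpos, hβ, hβpos⟩⟩

end TwoStageRO

namespace TwoStageRO

variable {mx nx μx nu μu ny μy : ℕ} {I : TwoStageRO mx nx μx nu μu ny μy}
  {x : Fin mx ⊕ Fin nx → ℝ} {S : Set (Fin μy → ℝ)} {s : MasterSol mx nx nu μu ny μy}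
  {it it' : ℕ → Iter mx nx nu μu ny μy} {t t₁ t₂ T : ℕ}

/-! ### The master problem -/

/-- Each KKT scenario lies in `𝒰(x)`, so its recourse value is below `η`. The strict inequality
gives a recourse decision without attainment of the infimum, and it allows `η = ⊤`. -/
theorem exists_masterFeasible (hI : I.StandingAssumptions) (hx : x ∈ I.X) {η : EReal}
    (hη : I.worstCase x < η) (S : Set (Fin μy → ℝ)) :
    ∃ s : MasterSol mx nx nu μu ny μy, I.MasterFeasible S s ∧ s.x = x ∧ s.η = η := by
  choose p hp using fun β => exists_mem_KKT hI hx β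
  have hy : ∀ β, ∃ y ∈ I.Y x (p β).1, ((I.c₂ ⬝ᵥ y : ℝ) : EReal) < η := by
    intro β
    have hU : (p β).1 ∈ I.U x := ⟨(hp β).2.2.2.2.1, (hp β).1⟩
    have hlt : I.recourseValue x (p β).1 < η :=
      (le_iSup₂ (f := fun u _ => I.recourseValue x u) _ hU).trans_lt hη
    obtain ⟨y, hy, h⟩ := (by simpa only [recourseValue, iInf_lt_iff, exists_prop] using hlt :
      ∃ y, y ∈ I.Y x (p β).1 ∧ ((I.c₂ ⬝ᵥ y : ℝ) : EReal) < η)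
    exact ⟨y, hy, h⟩
  choose y hy hlt using hy
  exact ⟨⟨x, η, fun β => (p β).1, fun β => (p β).2, y⟩,
    ⟨hx, fun β _ => ⟨hp β, hy β, (hlt β).le⟩⟩, rfl, rfl⟩

theorem exists_worstCase_eq_coe (hI : I.StandingAssumptions) (hx : I.Feasible x) :
    ∃ r : ℝ, I.worstCase x = r := by
  obtain ⟨us, -, -, β, -, h⟩ := exists_worstCase hI hx
  exact ⟨_, h.symm⟩

theorem feasible_of_cost_lt_top (hx : x ∈ I.X) (h : I.cost x < ⊤) : I.Feasible x := by
  refine feasible_of_worstCase_lt_top hx (lt_top_iff_ne_top.2 fun htop => ?_)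
  rw [cost, htop, EReal.coe_add_top] at h
  exact h.ne rfl

/-- The master problem is a relaxation of the robust problem. -/
theorem MasterOptimal.masterObj_le_cost (hI : I.StandingAssumptions) (hs : I.MasterOptimal S s)
    (hx : x ∈ I.X) : I.masterObj s ≤ I.cost x := by
  rcases eq_or_ne (I.cost x) ⊤ with htop | hne
  · rw [htop]
    exact le_top
  obtain ⟨r, hr⟩ := exists_worstCase_eq_coe hI (feasible_of_cost_lt_top hx hne.lt_top)
  -- Approximating the cost from above provides the strict gap needed by `exists_masterFeasible`.
  rw [← EReal.le_of_forall_lt_iff_le]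
  intro w hw
  rw [cost, hr, ← EReal.coe_add, EReal.coe_lt_coe_iff] at hw
  obtain ⟨s', hs', hx', hη'⟩ := exists_masterFeasible hI hx (η := ((w - I.c₁ ⬝ᵥ x : ℝ) : EReal))
    (by rw [hr, EReal.coe_lt_coe_iff]; linarith) S
  refine (hs.2 s' hs').trans (le_of_eq ?_)
  rw [masterObj, hx', hη', ← EReal.coe_add]
  congr 1
  ring

/-- Finitely many recourse costs have a real upper bound that can replace `η`. This later shows that
the incumbent is feasible when the test is met. -/
theorem MasterOptimal.masterObj_lt_top (hs : I.MasterOptimal S s) (hS : S.Finite) :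
    I.masterObj s < ⊤ := by
  obtain ⟨M, hM⟩ := (hS.image fun β => I.c₂ ⬝ᵥ s.y β).bddAbove
  refine (hs.2 { s with η := (M : EReal) } ⟨hs.1.1, fun β hβ =>
    ⟨(hs.1.2 β hβ).1, (hs.1.2 β hβ).2.1, ?_⟩⟩).trans_lt ?_
  · exact EReal.coe_le_coe_iff.2 (hM ⟨β, hβ, rfl⟩)
  · rw [masterObj, ← EReal.coe_add]
    exact EReal.coe_lt_top _

theorem MasterFeasible.mono {S' : Set (Fin μy → ℝ)} (h : S ⊆ S') (hs : I.MasterFeasible S' s) :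
    I.MasterFeasible S s :=
  ⟨hs.1, fun β hβ => hs.2 β (h hβ)⟩

/-! ### Bounds along a run -/

theorem cuts_mono (h : t₁ ≤ t₂) : cuts it t₁ ⊆ cuts it t₂ := fun _ ⟨s, hs, he⟩ =>
  ⟨s, hs.trans_le h, he⟩

theorem finite_cuts (it : ℕ → Iter mx nx nu μu ny μy) (t : ℕ) : (cuts it t).Finite :=
  ((Set.finite_Iio t).image fun s => (it s).cut).subset fun _ ⟨s, hs, he⟩ => ⟨s, hs, he.symm⟩

theorem UB_le_cost (it : ℕ → Iter mx nx nu μu ny μy) (t : ℕ) : I.UB it t ≤ I.cost (it t).x := by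
  cases t with
  | zero => exact le_rfl
  | succ t => exact min_le_right _ _

theorem UB_antitone (it : ℕ → Iter mx nx nu μu ny μy) : Antitone (I.UB it) :=
  antitone_nat_of_succ_le fun _ => min_le_left _ _

theorem cost_incumbent (it : ℕ → Iter mx nx nu μu ny μy) (t : ℕ) :
    I.cost (I.incumbent it t) = I.UB it t := by
  induction t with
  | zero => rfl
  | succ t ih =>
    rw [incumbent, UB]
    split_ifs with h
    · rw [min_eq_right h.le]
    · rw [ih, min_eq_left (not_lt.1 h)]

theorem exists_incumbent_eq (it : ℕ → Iter mx nx nu μu ny μy) (t : ℕ) :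
    ∃ s ≤ t, I.incumbent it t = (it s).x := by
  induction t with
  | zero => exact ⟨0, le_rfl, rfl⟩
  | succ t ih =>
    rw [incumbent]
    split_ifs with h
    · exact ⟨t + 1, le_rfl, rfl⟩
    · obtain ⟨s, hs, he⟩ := ih
      exact ⟨s, hs.trans t.le_succ, he⟩

theorem IsRun.mem_X (h : I.IsRun T it) (ht : t < T) : (it t).x ∈ I.X := (h t ht).1.1.1.1

theorem IsRun.LB_mono (h : I.IsRun T it) (h₁₂ : t₁ ≤ t₂) (h₂ : t₂ < T) : I.LB it t₁ ≤ I.LB it t₂ :=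
  (h t₁ (h₁₂.trans_lt h₂)).1.1.2 _ ((h t₂ h₂).1.1.1.mono (cuts_mono h₁₂))

/-- If one of the returned bases has nonpositive reduced costs for the new cut, then the master
problem is already exact at the current iterate. -/
theorem IsRun.cost_le_LB (h : I.IsRun T it) (ht : t < T) {J : Finset (Fin nu ⊕ Fin μu)}
    (hJ : J ∈ basesAt it t) (hr : I.NonposReducedCosts (it t).cut J) :
    I.Feasible (it t).x ∧ I.cost (it t).x ≤ I.LB it t := by
  obtain ⟨β, hβ, hJβ⟩ := hJ
  obtain ⟨z, hz, hu⟩ := ((h t ht).1.2 β hβ).2 J hJβ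
  -- The basis was returned for `β`; its primal feasibility combined with the reduced costs for the
  -- new cut makes the same scenario optimal for that cut.
  have hsol : I.SolvesLP (it t).x (it t).cut ((it t).u β) := by
    rw [funext hu]
    exact IsOptimalBasis.solvesLP ⟨hz.1, hr⟩
  obtain ⟨-, hy, hη⟩ := (h t ht).1.1.1.2 β hβ
  obtain ⟨uf, huf, -, ⟨hf, us, hus, -, hext, hval⟩ | ⟨-, hray, hpos⟩⟩ := (h t ht).2
  -- Chain: worst case = dual value at `us` ≤ dual value at the master scenario ≤ cost of the
  -- master's recourse decision ≤ `η`.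
  · refine ⟨feasible_of_etaF_eq_zero (h.mem_X ht) hf, add_le_add le_rfl (le_trans ?_ hη)⟩
    rw [← hval, EReal.coe_le_coe_iff]
    refine le_trans ?_ (need_dotProduct_le_of_mem_dualSet hext.1 hy)
    rw [need_dotProduct, need_dotProduct]
    exact add_le_add le_rfl (hsol.2 us hus)
  -- The master scenario has feasible recourse, so the ray is nonpositive there; yet that scenario
  -- maximizes the ray over `𝒰(x)`, where `uf` gives a positive value.
  · exfalso
    have h1 := need_dotProduct_nonpos_of_mem_dualCone hray.1 hy
    have h2 := hsol.2 uf huf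
    rw [need_dotProduct] at h1 hpos
    linarith

theorem IsRun.stopTest_of_mem_basesAt (hI : I.StandingAssumptions) (h : I.IsRun T it) (ht : t < T)
    {J : Finset (Fin nu ⊕ Fin μu)} (hJ : J ∈ basesAt it t)
    (hr : I.NonposReducedCosts (it t).cut J) : I.StopTest it t ∧ I.Optimal (it t).x := by
  obtain ⟨hf, hle⟩ := h.cost_le_LB ht hJ hr
  exact ⟨(UB_le_cost it t).trans hle, hf, fun x' hx' =>
    hle.trans ((h t ht).1.1.masterObj_le_cost hI hx')⟩

/-- The test at `t₁` passes to `t₂` because `UB` decreases and `LB` increases. -/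
theorem IsRun.stopTest_of_basesAt_eq (hI : I.StandingAssumptions) (h : I.IsRun T it)
    (h₁₂ : t₁ < t₂) (h₂ : t₂ < T) (hB : basesAt it t₁ = basesAt it t₂) :
    I.StopTest it t₁ ∧ I.StopTest it t₂ ∧ I.Optimal (it t₁).x := by
  have hcut : (it t₁).cut ∈ cuts it t₂ := ⟨t₁, h₁₂, rfl⟩
  obtain ⟨⟨J, hJ⟩, hbas⟩ := (h t₂ h₂).1.2 _ hcut
  obtain ⟨z, hz, -⟩ := hbas J hJ
  obtain ⟨htest, hopt⟩ := h.stopTest_of_mem_basesAt hI (h₁₂.trans h₂) (hB ▸ ⟨_, hcut, hJ⟩) hz.2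
  exact ⟨htest, ((UB_antitone it h₁₂.le).trans htest).trans (h.LB_mono h₁₂.le h₂), hopt⟩

/-- The number of iterations in which the stopping test fails. -/
theorem IsRun.succ_le_two_pow (hI : I.StandingAssumptions) (h : I.IsRun T it)
    (htest : ∀ t < T, ¬ I.StopTest it t) : T + 1 ≤ 2 ^ (nu + μu).choose μu := by
  classical
  set P : Finset (Finset (Fin nu ⊕ Fin μu)) := Finset.univ.powersetCard μu with hP
  have hcard : P.powerset.card = 2 ^ (nu + μu).choose μu := by
    rw [Finset.card_powerset, hP, Finset.card_powersetCard, Finset.card_univ, Fintype.card_sum,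
      Fintype.card_fin, Fintype.card_fin]
  -- Erasing `P` itself saves the one iteration that the `T + 1` in the bound requires.
  have hle : (Finset.range T).card ≤ (P.powerset.erase P).card := by
    refine Finset.card_le_card_of_injOn (fun t => Finset.univ.filter fun J => J ∈ basesAt it t) ?_ ?_
    · intro t ht
      have htT : t < T := by simpa using ht
      rw [Finset.mem_coe, Finset.mem_erase, Finset.mem_powerset]
      constructor
      · intro he
        obtain ⟨J, hJ, hr⟩ := exists_nonposReducedCosts hI (h.mem_X htT) (it t).cut
        have hJP : J ∈ P := Finset.mem_powersetCard.2 ⟨Finset.subset_univ J, hJ⟩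
        rw [← he] at hJP
        exact htest t htT
          (h.stopTest_of_mem_basesAt hI htT (Finset.mem_filter.1 hJP).2 hr).1
      · intro J hJ
        obtain ⟨β, hβ, hJβ⟩ := (Finset.mem_filter.1 hJ).2
        obtain ⟨z, hz, -⟩ := ((h t htT).1.2 β hβ).2 J hJβ
        exact Finset.mem_powersetCard.2 ⟨Finset.subset_univ J, hz.1.1.1.1⟩
    · have key : ∀ t₁ t₂, t₁ < t₂ → t₂ < T →
          (Finset.univ.filter fun J => J ∈ basesAt it t₁) ≠
            Finset.univ.filter fun J => J ∈ basesAt it t₂ := by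
        intro t₁ t₂ h₁₂ h₂ he
        refine htest t₁ (h₁₂.trans h₂) (h.stopTest_of_basesAt_eq hI h₁₂ h₂ ?_).1
        ext J
        simpa using Finset.ext_iff.1 he J
      intro t₁ h₁ t₂ h₂ he
      have h₁' : t₁ < T := by simpa using h₁
      have h₂' : t₂ < T := by simpa using h₂
      rcases lt_trichotomy t₁ t₂ with hlt | heq | hgt
      · exact absurd he (key t₁ t₂ hlt h₂')
      · exact heq
      · exact absurd he.symm (key t₂ t₁ hgt h₁')
  rw [Finset.card_range, Finset.card_erase_of_mem (Finset.mem_powerset_self P), hcard] at hle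
  have := Nat.one_le_two_pow (n := (nu + μu).choose μu)
  omega

/-- The last iteration may meet the test; only the earlier ones are known to fail it, and the spare
unit accounts for the last. -/
theorem IsExecution.le_two_pow (hI : I.StandingAssumptions) (h : I.IsExecution T it) :
    T ≤ 2 ^ (nu + μu).choose μu := by
  cases T with
  | zero => exact Nat.zero_le _
  | succ T =>
    exact IsRun.succ_le_two_pow hI (fun t ht => h.1 t (ht.trans T.lt_succ_self))
      (fun t ht => h.2 t (Nat.succ_lt_succ ht))

theorem Converges.optimal (hI : I.StandingAssumptions) (h : I.Converges T it) :
    I.LB it (T - 1) = I.optValue ∧ I.UB it (T - 1) = I.optValue ∧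
      I.Optimal (I.incumbent it (T - 1)) := by
  obtain ⟨⟨hrun, -⟩, hT, htest⟩ := h
  have hlt : T - 1 < T := Nat.sub_lt hT one_pos
  have hopt := (hrun _ hlt).1.1
  obtain ⟨s, hs, hinc⟩ := exists_incumbent_eq (I := I) it (T - 1)
  have hX : I.incumbent it (T - 1) ∈ I.X := hinc ▸ hrun.mem_X (hs.trans_lt hlt)
  have hLB : ∀ x ∈ I.X, I.LB it (T - 1) ≤ I.cost x := fun x hx => hopt.masterObj_le_cost hI hx
  have h1 : I.LB it (T - 1) ≤ I.optValue := le_iInf₂ hLB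
  have h2 : I.optValue ≤ I.UB it (T - 1) := by
    rw [← cost_incumbent]
    exact iInf₂_le _ hX
  refine ⟨h1.antisymm (h2.trans htest), (htest.trans h1).antisymm h2, ?_, fun x hx => ?_⟩
  · refine feasible_of_cost_lt_top hX ?_
    rw [cost_incumbent]
    exact htest.trans_lt (hopt.masterObj_lt_top (finite_cuts it _))
  · rw [cost_incumbent]
    exact htest.trans (hLB x hx)

/-- A feasible first stage decision would extend to a master solution with `η = ⊤`. -/
theorem infeasible_of_not_masterFeasible (hI : I.StandingAssumptions)
    (h : ¬ ∃ s, I.MasterFeasible S s) : I.Infeasible := by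
  intro x hx
  obtain ⟨r, hr⟩ := exists_worstCase_eq_coe hI hx
  obtain ⟨s, hs, -⟩ := exists_masterFeasible hI hx.1 (η := ⊤) (hr ▸ EReal.coe_lt_top r) S
  exact h ⟨s, hs⟩

/-! ### Continuing an execution -/

theorem cuts_congr (h : ∀ s < t, it' s = it s) : cuts it' t = cuts it t := by
  ext β
  exact exists_congr fun s => and_congr_right fun hs => by rw [h s hs]

theorem UB_congr (h : ∀ s ≤ t, it' s = it s) : I.UB it' t = I.UB it t := by
  induction t with
  | zero => rw [UB, UB, h 0 le_rfl]
  | succ t ih => rw [UB, UB, h (t + 1) le_rfl, ih fun s hs => h s (hs.trans t.le_succ)]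

theorem stopTest_congr (h : ∀ s ≤ t, it' s = it s) : I.StopTest it' t ↔ I.StopTest it t := by
  rw [StopTest, StopTest, UB_congr h, LB, LB, h t le_rfl]

theorem SubproblemAnswer.extremePoint_or_ray {β : Fin μy → ℝ} (h : I.SubproblemAnswer x β) :
    β ∈ I.dualSet.extremePoints ℝ ∨ I.IsExtremeRay β := by
  obtain ⟨uf, -, -, ⟨-, us, -, -, hβ, -⟩ | ⟨-, hβ, -⟩⟩ := h
  · exact Or.inl hβ
  · exact Or.inr hβ

theorem IsRun.exists_extend (hI : I.StandingAssumptions) (hM : I.MasterSolvable)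
    (h : I.IsRun T it) (htest : ∀ t < T, ¬ I.StopTest it t)
    (hfeas : ∃ s, I.MasterFeasible (cuts it T) s) :
    ∃ it', (∀ t < T, it' t = it t) ∧ I.IsExecution (T + 1) it' := by
  obtain ⟨s, bases, hans⟩ := hM (cuts it T) (finite_cuts it T)
    (by rintro _ ⟨t, ht, rfl⟩; exact (h t ht).2.extremePoint_or_ray) hfeas
  obtain ⟨β, hβ⟩ := exists_subproblemAnswer hI hans.1.1.1
  have hold : ∀ t < T, Function.update it T ⟨s, bases, β⟩ t = it t := fun t ht =>
    Function.update_of_ne ht.ne _ _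
  refine ⟨Function.update it T ⟨s, bases, β⟩, hold, fun t ht => ?_, fun t ht => ?_⟩
  · rw [cuts_congr fun s hs => hold s (hs.trans_le (Nat.lt_succ_iff.1 ht))]
    rcases (Nat.lt_succ_iff.1 ht).lt_or_eq with hlt | rfl
    · rw [hold t hlt]
      exact h t hlt
    · rw [Function.update_self]
      exact ⟨hans, hβ⟩
  · have htT : t < T := Nat.succ_lt_succ_iff.1 ht
    rw [stopTest_congr fun s hs => hold s (hs.trans_lt htT)]
    exact htest t htT

theorem IsExecution.converges_or_forall_not_stopTest (h : I.IsExecution T it) :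
    I.Converges T it ∨ ∀ t < T, ¬ I.StopTest it t := by
  refine or_iff_not_imp_left.2 fun hc t ht hst => ?_
  rcases (Nat.succ_le_of_lt ht).lt_or_eq with hlt | rfl
  · exact h.2 t hlt hst
  · exact hc ⟨h, t.succ_pos, hst⟩

theorem IsExecution.exists_continuation (hI : I.StandingAssumptions) (hM : I.MasterSolvable)
    (h : I.IsExecution T it) :
    ∃ (T' : ℕ) (it' : ℕ → Iter mx nx nu μu ny μy), T ≤ T' ∧ (∀ t < T, it' t = it t) ∧
      (I.Converges T' it' ∨ I.ReportsInfeasible T' it') := by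
  -- The induction runs on the number of iterations left before the bound. At `k = 0` another failed
  -- test would exceed it.
  obtain ⟨k, hk⟩ : ∃ k, 2 ^ (nu + μu).choose μu ≤ T + k := ⟨_, Nat.le_add_left _ _⟩
  induction k generalizing T it with
  | zero =>
    rcases h.converges_or_forall_not_stopTest with hc | htest
    · exact ⟨T, it, le_rfl, fun _ _ => rfl, Or.inl hc⟩
    · have := h.1.succ_le_two_pow hI htest
      omega
  | succ k ih =>
    rcases h.converges_or_forall_not_stopTest with hc | htest
    · exact ⟨T, it, le_rfl, fun _ _ => rfl, Or.inl hc⟩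
    · by_cases hfeas : ∃ s, I.MasterFeasible (cuts it T) s
      · obtain ⟨it₁, hold, hex⟩ := h.1.exists_extend hI hM htest hfeas
        obtain ⟨T', it', hT', hold', hend⟩ := ih hex (by omega)
        exact ⟨T', it', T.le_succ.trans hT', fun t ht =>
          (hold' t (ht.trans T.lt_succ_self)).trans (hold t ht), hend⟩
      · exact ⟨T, it, le_rfl, fun _ _ => rfl, Or.inr ⟨h, htest, hfeas⟩⟩

end TwoStageRO

/-! ### The main theorem. -/

theorem mainTheorem5 {mx nx μx nu μu ny μy : ℕ} (I : TwoStageRO mx nx μx nu μu ny μy)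
    (hI : I.StandingAssumptions) :
    -- an optimal basis stays optimal whenever it remains feasible
    (∀ (β : Fin μy → ℝ) (J : Finset (Fin nu ⊕ Fin μu)) (x₀ x₁ : Fin mx ⊕ Fin nx → ℝ)
        (z₀ z₁ : Fin nu ⊕ Fin μu → ℝ),
      I.IsOptimalBasis x₀ β J z₀ → I.IsBFS x₁ J z₁ →
        I.IsOptimalBasis x₁ β J z₁ ∧ I.SolvesLP x₁ β (fun i => z₁ (Sum.inl i))) ∧
    -- a repeated set of bases forces termination
    (∀ (T : ℕ) (it : ℕ → TwoStageRO.Iter mx nx nu μu ny μy) (t₁ t₂ : ℕ),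
      I.IsRun T it → t₁ < t₂ → t₂ < T →
      TwoStageRO.basesAt it t₁ = TwoStageRO.basesAt it t₂ →
        I.StopTest it t₁ ∧ I.StopTest it t₂ ∧ I.Optimal (it t₁).x) ∧
    -- number of iterations and correctness of the two possible outcomes
    (∀ (T : ℕ) (it : ℕ → TwoStageRO.Iter mx nx nu μu ny μy), I.IsExecution T it →
      T ≤ 2 ^ (nu + μu).choose μu ∧
      (I.Converges T it →
        I.LB it (T - 1) = I.optValue ∧ I.UB it (T - 1) = I.optValue ∧
        I.Optimal (I.incumbent it (T - 1))) ∧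
      (I.ReportsInfeasible T it → T + 1 ≤ 2 ^ (nu + μu).choose μu ∧ I.Infeasible)) ∧
    -- every execution continues until one of the two outcomes occurs
    (I.MasterSolvable →
      ∀ (T : ℕ) (it : ℕ → TwoStageRO.Iter mx nx nu μu ny μy), I.IsExecution T it →
        ∃ (T' : ℕ) (it' : ℕ → TwoStageRO.Iter mx nx nu μu ny μy),
          T ≤ T' ∧ (∀ t < T, it' t = it t) ∧
          (I.Converges T' it' ∨ I.ReportsInfeasible T' it')) := by
  -- The reduced cost condition `h₀.2` does not involve the first stage decision, so it carries over
  -- to `x₁` verbatim.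
  refine ⟨fun β J x₀ x₁ z₀ z₁ h₀ h₁ => ⟨⟨h₁, h₀.2⟩, TwoStageRO.IsOptimalBasis.solvesLP ⟨h₁, h₀.2⟩⟩,
    fun T it t₁ t₂ h h₁₂ h₂ hB => h.stopTest_of_basesAt_eq hI h₁₂ h₂ hB,
    fun T it h => ⟨h.le_two_pow hI, fun hc => hc.optimal hI, fun hr =>
      ⟨h.1.succ_le_two_pow hI hr.2.1, TwoStageRO.infeasible_of_not_masterFeasible hI hr.2.2⟩⟩,
    fun hM T it h => h.exists_continuation hI hM⟩
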